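/- Let $d\ge 1$, let $\Omega\subset\mathbb R^d$ be closed and convex, let $\rho>0$, and let $\bar\mu$ be a probability measure on $\mathbb R^d$ concentrated on $\Omega$ (i.e. $\bar\mu(\mathbb R^d\setminus\Omega)=0$) with Lebesgue density $\bar u(x)=A\,[(\rho^2-|x|^2)\vee 0]$. Let $R:[0,1]\to[0,1]$ be of class $C^1$ and monotone (nondecreasing or nonincreasing), with $R'(t)\neq 0$ for a.e. $t\in[0,1]$. Put $\mu_t=(T_{R(t)})_\sharp\bar\mu$, where $T_r(x)=rx$, and, where $R(t)>0$, $v_t(x)=x\,R'(t)/R(t)$ and $u_t(x)=R(t)^{-d}\,\bar u(x/R(t))$. Note that $R>0$ on $]0,1[$; $R$ may vanish at one endpoint, where $\mu_t=\delta_0$. Then: 1. $t\mapsto\mu_t$, $t\in[0,1]$, is a Lipschitz curve in the Wasserstein space $W_2(\Omega)$, and $v$ is its tangent field: $v$ is a velocity field, meaning that $v_t\in L^2(\mu_t)$ for a.e. $t$ and $\int\phi\,d\mu_{t_2}-\int\phi\,d\mu_{t_1}=\int_{t_1}^{t_2}\int\nabla\phi\cdot v_s\,d\mu_s\,ds$ for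 all $\phi\in C^1_c(\mathbb R^d)$ and $0\le t_1<t_2\le 1$; and for a.e. $t$ the norm $\|v_t\|_{L^2(\mu_t)}$ is minimal among all velocity fields of the curve. 2. For $t\in\,]0,1[$, $u_t$ is the Lebesgue density of $\mu_t$, and $(u,v)$ is a weak (distributional) solution on $]0,1[\,\times\Omega$ of the system $$\begin{cases}H(t)\nabla u^2+K(t)\,\nabla\cdot(u\,v\otimes v)+\frac{d}{dt}\big(K(t)\,u\,v\big)=0&\text{in }\Omega,\\ \frac{d}{dt}u+\nabla\cdot(v\,u)=0&\text{in }\Omega,\\ u\,v\cdot n=0&\text{on }\partial\Omega,\\ \lim_{t\downarrow0}u_t\mathcal L^d=\mu_0,\quad \lim_{t\uparrow1}u_t\mathcal L^d=\mu_1&\text{(narrow limits),}\end{cases}$$ where $$H(t)=-V(t)^{1/2},\quad K(t)=F(t)\,V(t)^{-1/2},\quad F(t)=\int_\Omega u_t^2\,dx,\quad V(t)=\int_\Omega|v_t|^2u_t\,dx;$$ here, for a.e. $t\in\,]0,1[$, $F(t)$ and $V(t)$ are finite and $V(t)>0$, and the functions $Hu^2$, $Ku\,v_iv_j$, $Ku\,v$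 are locally integrable on $]0,1[\,\times\operatorname{int}\Omega$, while $u$ and $u\,v$ are locally integrable on $]0,1[\,\times\Omega$. The first equation means $$\int_0^1\!\!\int_\Omega H\,u^2\,\nabla\cdot\xi+K\,u\,v\cdot(\nabla\xi\, v+\partial_t\xi)\,dx\,dt=0\qquad\text{for all }\xi\in C_c^\infty(]0,1[\,\times\operatorname{int}\Omega;\mathbb R^d),$$ and the second means $$\int_0^1\!\!\int_\Omega u\,(\partial_t\varphi+v\cdot\nabla\varphi)\,dx\,dt=0\qquad\text{for all }\varphi\in C^\infty_c(]0,1[\,\times\mathbb R^d)$$ (test functions need not vanish on $\partial\Omega$, so this also contains the weak form of the boundary condition). The boundary condition moreover holds pointwise: $u_t(x)\,v_t(x)\cdot n=0$ for all $t\in\,]0,1[$, all $x\in\partial\Omega$ and all $n$ in the normal cone to $\Omega$ at $x$. -/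

import Mathlib

open MeasureTheory Set Filter Topology
open scoped ENNReal NNReal ContDiff

namespace WeightedWasserstein

variable {d : ℕ}

/-- The density profile `x ↦ A [(ρ² - |x|²) ∨ 0]`. -/
noncomputable def parabolicDensity (A ρ : ℝ) (x : EuclideanSpace ℝ (Fin d)) : ℝ :=
  A * max (ρ ^ 2 - ‖x‖ ^ 2) 0

/-! ### Curves in Wasserstein spaces, velocity fields and tangent fields -/

/-- Transport plans between `μ` and `ν`. -/
def couplings (μ ν : Measure (EuclideanSpace ℝ (Fin d))) :
    Set (Measure (EuclideanSpace ℝ (Fin d) × EuclideanSpace ℝ (Fin d))) :=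
  {π | π.map Prod.fst = μ ∧ π.map Prod.snd = ν}

/-- The Wasserstein distance of order `p`. -/
noncomputable def wassersteinDist (p : ℝ) (μ ν : Measure (EuclideanSpace ℝ (Fin d))) : ℝ≥0∞ :=
  (⨅ π ∈ couplings μ ν, ∫⁻ z, edist z.1 z.2 ^ p ∂π) ^ (1 / p)

/-- `μ` belongs to `W_p(Ω)`: a probability measure on `Ω` (seen as a measure on `ℝᵈ` concentrated
on `Ω`) with finite moment of order `p`. -/
structure MemWasserstein (Ω : Set (EuclideanSpace ℝ (Fin d))) (p : ℝ)
    (μ : Measure (EuclideanSpace ℝ (Fin d))) : Prop where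
  prob : IsProbabilityMeasure μ
  concentrated : μ Ωᶜ = 0
  moment : ∫⁻ x, ‖x‖ₑ ^ p ∂μ < ⊤

/-- `t ↦ μ t`, `t ∈ [0,1]`, is a Lipschitz curve with values in `W_p(Ω)`. -/
structure IsLipschitzCurve (Ω : Set (EuclideanSpace ℝ (Fin d))) (p : ℝ)
    (μ : ℝ → Measure (EuclideanSpace ℝ (Fin d))) : Prop where
  mem : ∀ t ∈ Icc (0 : ℝ) 1, MemWasserstein Ω p (μ t)
  lipschitz : ∃ L : ℝ≥0, ∀ s ∈ Icc (0 : ℝ) 1, ∀ t ∈ Icc (0 : ℝ) 1,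
    wassersteinDist p (μ s) (μ t) ≤ L * edist s t

/-- `v` is a velocity field of the curve `μ`: a Borel vector field on `[0,1] × Ω` with
`v_t ∈ L^p(μ_t)` for a.e. `t`, such that `d/dt μ_t + ∇·(v_t μ_t) = 0` in the sense of
distributions. The test functions are the restrictions to the closed set `Ω` of `C¹` functions
with compact support, so no flux through `∂Ω` is allowed. -/
structure IsVelocityField (Ω : Set (EuclideanSpace ℝ (Fin d))) (p : ℝ)
    (μ : ℝ → Measure (EuclideanSpace ℝ (Fin d)))
    (v : ℝ → EuclideanSpace ℝ (Fin d) → EuclideanSpace ℝ (Fin d)) : Prop where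
  measurable : Measurable ((Icc (0 : ℝ) 1 ×ˢ Ω).domRestrict (fun z => v z.1 z.2))
  memLp : ∀ᵐ t ∂(volume.restrict (Icc (0 : ℝ) 1)), MemLp (v t) (ENNReal.ofReal p) (μ t)
  continuity : ∀ φ : EuclideanSpace ℝ (Fin d) → ℝ, ContDiff ℝ 1 φ → HasCompactSupport φ →
    ∀ t₁ ∈ Icc (0 : ℝ) 1, ∀ t₂ ∈ Icc (0 : ℝ) 1, t₁ < t₂ →
      IntervalIntegrable (fun s => ∫ x, fderiv ℝ φ x (v s x) ∂(μ s)) volume t₁ t₂ ∧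
      ∫ x, φ x ∂(μ t₂) - ∫ x, φ x ∂(μ t₁) = ∫ s in t₁..t₂, ∫ x, fderiv ℝ φ x (v s x) ∂(μ s)

/-- `v` is the tangent field of the curve `μ`: a velocity field which for a.e. `t` has minimal
`L^p(μ_t)` norm among all velocity fields. -/
structure IsTangentField (Ω : Set (EuclideanSpace ℝ (Fin d))) (p : ℝ)
    (μ : ℝ → Measure (EuclideanSpace ℝ (Fin d)))
    (v : ℝ → EuclideanSpace ℝ (Fin d) → EuclideanSpace ℝ (Fin d)) : Prop where
  velocity : IsVelocityField Ω p μ v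
  minimal : ∀ w, IsVelocityField Ω p μ w → ∀ᵐ t ∂(volume.restrict (Icc (0 : ℝ) 1)),
    eLpNorm (v t) (ENNReal.ofReal p) (μ t) ≤ eLpNorm (w t) (ENNReal.ofReal p) (μ t)

/-! ### The optimality system -/

/-- `F(t) = ∫_Ω u_t^q dx`. -/
noncomputable def energyF (Ω : Set (EuclideanSpace ℝ (Fin d))) (q : ℝ)
    (u : ℝ → EuclideanSpace ℝ (Fin d) → ℝ) (t : ℝ) : ℝ :=
  ∫ x in Ω, u t x ^ q

/-- `V(t) = ∫_Ω |v_t|^p u_t dx`. -/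
noncomputable def energyV (Ω : Set (EuclideanSpace ℝ (Fin d))) (p : ℝ)
    (u : ℝ → EuclideanSpace ℝ (Fin d) → ℝ)
    (v : ℝ → EuclideanSpace ℝ (Fin d) → EuclideanSpace ℝ (Fin d)) (t : ℝ) : ℝ :=
  ∫ x in Ω, ‖v t x‖ ^ p * u t x

/-- `H(t) = α (1 - q) F(t)^(α-1) V(t)^β`. -/
noncomputable def coeffH (Ω : Set (EuclideanSpace ℝ (Fin d))) (p q α β : ℝ)
    (u : ℝ → EuclideanSpace ℝ (Fin d) → ℝ)
    (v : ℝ → EuclideanSpace ℝ (Fin d) → EuclideanSpace ℝ (Fin d)) (t : ℝ) : ℝ :=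
  α * (1 - q) * energyF Ω q u t ^ (α - 1) * energyV Ω p u v t ^ β

/-- `K(t) = p β F(t)^α V(t)^(β-1)`. -/
noncomputable def coeffK (Ω : Set (EuclideanSpace ℝ (Fin d))) (p q α β : ℝ)
    (u : ℝ → EuclideanSpace ℝ (Fin d) → ℝ)
    (v : ℝ → EuclideanSpace ℝ (Fin d) → EuclideanSpace ℝ (Fin d)) (t : ℝ) : ℝ :=
  p * β * energyF Ω q u t ^ α * energyV Ω p u v t ^ (β - 1)

/-- The spatial divergence of a time-dependent vector field. -/
noncomputable def spaceDiv (ξ : ℝ × EuclideanSpace ℝ (Fin d) → EuclideanSpace ℝ (Fin d))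
    (t : ℝ) (x : EuclideanSpace ℝ (Fin d)) : ℝ :=
  ∑ i, (fderiv ℝ (fun y => ξ (t, y)) x (EuclideanSpace.single i 1)) i

/-- `(u, v)` is a weak (distributional) solution on `]0,1[ × Ω` of the system
* `H(t) ∇u^q + K(t) ∇·(u |v|^(p-2) v ⊗ v) + d/dt (K(t) u |v|^(p-2) v) = 0` in `Ω`,
* `d/dt u + ∇·(v u) = 0` in `Ω`,
* `u v · n = 0` on `∂Ω`,
* `u_t 𝓛ᵈ → μ₀` as `t ↓ 0` and `u_t 𝓛ᵈ → μ₁` as `t ↑ 1` (narrowly),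
with `H`, `K` the functions of time `coeffH`, `coeffK`. -/
structure IsWeakSolution (Ω : Set (EuclideanSpace ℝ (Fin d))) (p q α β : ℝ)
    (μ₀ μ₁ : Measure (EuclideanSpace ℝ (Fin d)))
    (u : ℝ → EuclideanSpace ℝ (Fin d) → ℝ)
    (v : ℝ → EuclideanSpace ℝ (Fin d) → EuclideanSpace ℝ (Fin d)) : Prop where
  /-- `u_t` is a probability density on `Ω`. -/
  nonneg : ∀ t ∈ Ioo (0 : ℝ) 1, ∀ x, 0 ≤ u t x
  mass : ∀ t ∈ Ioo (0 : ℝ) 1, ∫ x in Ω, u t x = 1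
  /-- `F`, `V`, `H`, `K` are well defined for a.e. time. -/
  finite_F : ∀ᵐ t ∂(volume.restrict (Ioo (0 : ℝ) 1)), IntegrableOn (fun x => u t x ^ q) Ω
  finite_V : ∀ᵐ t ∂(volume.restrict (Ioo (0 : ℝ) 1)),
    IntegrableOn (fun x => ‖v t x‖ ^ p * u t x) Ω
  pos_V : β < 1 → ∀ᵐ t ∂(volume.restrict (Ioo (0 : ℝ) 1)), 0 < energyV Ω p u v t
  /-- The terms of the equations are locally integrable, hence define distributions. -/
  locInt_pressure : LocallyIntegrableOn
    (fun z : ℝ × EuclideanSpace ℝ (Fin d) => coeffH Ω p q α β u v z.1 * u z.1 z.2 ^ q)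
    (Ioo (0 : ℝ) 1 ×ˢ interior Ω)
  locInt_tensor : ∀ i j, LocallyIntegrableOn
    (fun z : ℝ × EuclideanSpace ℝ (Fin d) =>
      coeffK Ω p q α β u v z.1 * u z.1 z.2 * ‖v z.1 z.2‖ ^ (p - 2) * (v z.1 z.2 i * v z.1 z.2 j))
    (Ioo (0 : ℝ) 1 ×ˢ interior Ω)
  locInt_momentum : LocallyIntegrableOn
    (fun z : ℝ × EuclideanSpace ℝ (Fin d) =>
      (coeffK Ω p q α β u v z.1 * u z.1 z.2 * ‖v z.1 z.2‖ ^ (p - 2)) • v z.1 z.2)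
    (Ioo (0 : ℝ) 1 ×ˢ interior Ω)
  locInt_density : LocallyIntegrableOn
    (fun z : ℝ × EuclideanSpace ℝ (Fin d) => u z.1 z.2) (Ioo (0 : ℝ) 1 ×ˢ Ω)
  locInt_flux : LocallyIntegrableOn
    (fun z : ℝ × EuclideanSpace ℝ (Fin d) => u z.1 z.2 • v z.1 z.2) (Ioo (0 : ℝ) 1 ×ˢ Ω)
  /-- First equation, tested against `ξ ∈ C_c^∞(]0,1[ × int Ω; ℝᵈ)`. -/
  momentum : ∀ ξ : ℝ × EuclideanSpace ℝ (Fin d) → EuclideanSpace ℝ (Fin d),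
    ContDiff ℝ ∞ ξ → HasCompactSupport ξ → tsupport ξ ⊆ Ioo (0 : ℝ) 1 ×ˢ interior Ω →
    ∫ z in Ioo (0 : ℝ) 1 ×ˢ Ω,
      (coeffH Ω p q α β u v z.1 * u z.1 z.2 ^ q * spaceDiv ξ z.1 z.2
        + coeffK Ω p q α β u v z.1 * u z.1 z.2 * ‖v z.1 z.2‖ ^ (p - 2) *
          (inner ℝ (v z.1 z.2) (fderiv ℝ (fun y => ξ (z.1, y)) z.2 (v z.1 z.2))
            + inner ℝ (v z.1 z.2) (deriv (fun s => ξ (s, z.2)) z.1))) = 0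
  /-- Second equation together with the weak form of `u v · n = 0` on `∂Ω`: the test functions
  need not vanish on `∂Ω`. -/
  continuity : ∀ φ : ℝ × EuclideanSpace ℝ (Fin d) → ℝ,
    ContDiff ℝ ∞ φ → HasCompactSupport φ → tsupport φ ⊆ Ioo (0 : ℝ) 1 ×ˢ univ →
    ∫ z in Ioo (0 : ℝ) 1 ×ˢ Ω,
      u z.1 z.2 * (deriv (fun s => φ (s, z.2)) z.1
        + fderiv ℝ (fun y => φ (z.1, y)) z.2 (v z.1 z.2)) = 0
  /-- Initial and final conditions. -/
  initial : ∀ f : BoundedContinuousFunction (EuclideanSpace ℝ (Fin d)) ℝ,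
    Tendsto (fun t => ∫ x in Ω, f x * u t x) (𝓝[>] 0) (𝓝 (∫ x, f x ∂μ₀))
  final : ∀ f : BoundedContinuousFunction (EuclideanSpace ℝ (Fin d)) ℝ,
    Tendsto (fun t => ∫ x in Ω, f x * u t x) (𝓝[<] 1) (𝓝 (∫ x, f x ∂μ₁))

/-- The boundary condition `u v · n = 0` on `∂Ω` in the classical sense, for every `t ∈ ]0,1[` and
every normal `n` to the convex set `Ω` at a boundary point. -/
def NoFlux (Ω : Set (EuclideanSpace ℝ (Fin d)))
    (u : ℝ → EuclideanSpace ℝ (Fin d) → ℝ)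
    (v : ℝ → EuclideanSpace ℝ (Fin d) → EuclideanSpace ℝ (Fin d)) : Prop :=
  ∀ t ∈ Ioo (0 : ℝ) 1, ∀ x ∈ frontier Ω, ∀ n : EuclideanSpace ℝ (Fin d),
    (∀ y ∈ Ω, inner ℝ n (y - x) ≤ 0) → inner ℝ (u t x • v t x) n = 0

/-- The homothetic curve `μ_t = (T_{R(t)})_♯ μ̄`, where `T_r(x) = r x`. -/
noncomputable def homotheticCurve (R : ℝ → ℝ) (μbar : Measure (EuclideanSpace ℝ (Fin d))) (t : ℝ) :
    Measure (EuclideanSpace ℝ (Fin d)) :=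
  μbar.map (fun x => R t • x)

/-- The density `R(t)^(-d) ū(x / R(t))` of the homothetic curve, `ū` being the density of `μ̄`. -/
noncomputable def homotheticDensity (R : ℝ → ℝ) (ubar : EuclideanSpace ℝ (Fin d) → ℝ) (t : ℝ)
    (x : EuclideanSpace ℝ (Fin d)) : ℝ :=
  (R t ^ d)⁻¹ * ubar ((R t)⁻¹ • x)

/-- The vector field `v_t(x) = x R'(t) / R(t)`, `t ∈ [0,1]`. -/
noncomputable def homotheticField (R : ℝ → ℝ) (t : ℝ) (x : EuclideanSpace ℝ (Fin d)) :
    EuclideanSpace ℝ (Fin d) :=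
  (derivWithin R (Icc (0 : ℝ) 1) t / R t) • x

end WeightedWasserstein

/-! In the Lagrangian coordinate `x = R(t) y` every integral against `μ_t` becomes an integral
against the fixed measure `μ̄`. Since `Ω` is closed and carries `μ̄`, it contains the closed ball of
radius `ρ`; since `R ≤ 1`, no `μ_t` leaves that ball. Compactness then justifies all
differentiations under the integral sign.

The field satisfies `v_t(R(t) y) = R'(t) y`, so the continuity equation is the chain rule for `φ(t,
R(t) y)`, integrated in time. The field is tangent because `v_t` is a multiple of `x = ∇(|x|²/2)`:
testing another velocity field `w` against `|x|²/2` gives `∫ v_t·w_t dμ_t = ∫ |v_t|² dμ_t`, and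
Cauchy–Schwarz concludes.

For the momentum equation put `M = ∫ ū|y|²`, `F̄ = ∫ ū²`. Then `V = R'² M`, `F = R^(-d) F̄`. As `R'`
has a constant sign `σ`, it cancels from `K v = σ (F̄/√M) R^(-d) x/R`. The time integral of `d/dt ∫
R^(-d) y·ξ(t, R y) dμ̄` vanishes. Differentiating `R^(-d)` leaves a term in `∫ y·ξ dμ̄`, which the
pressure must balance; the pressure is of the same form because `∇(ū²) = -4A ū y`
(`integral_parabolicDensity_sq_mul_div`). The constants agree exactly when `d F̄ = 4A M`, which is
the same identity tested with the field `y` (`dim_mul_integral_parabolicDensity_sq`). -/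

namespace WeightedWasserstein

/-! ### The parabolic profile and its support. -/

section Density

variable {d : ℕ} {A ρ : ℝ}

theorem continuous_parabolicDensity :
    Continuous (parabolicDensity A ρ : EuclideanSpace ℝ (Fin d) → ℝ) := by
  unfold parabolicDensity
  fun_prop

theorem parabolicDensity_nonneg (hA : 0 ≤ A) (x : EuclideanSpace ℝ (Fin d)) :
    0 ≤ parabolicDensity A ρ x :=
  mul_nonneg hA (le_max_right _ _)

theorem parabolicDensity_eq_zero (hρ : 0 ≤ ρ) {x : EuclideanSpace ℝ (Fin d)} (hx : ρ ≤ ‖x‖) :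
    parabolicDensity A ρ x = 0 := by
  have : ρ ^ 2 - ‖x‖ ^ 2 ≤ 0 := by nlinarith [norm_nonneg x]
  simp [parabolicDensity, max_eq_right this]

theorem parabolicDensity_pos (hA : 0 < A) {x : EuclideanSpace ℝ (Fin d)} (hx : ‖x‖ < ρ) :
    0 < parabolicDensity A ρ x := by
  have : 0 < ρ ^ 2 - ‖x‖ ^ 2 := by nlinarith [norm_nonneg x]
  exact mul_pos hA (lt_max_of_lt_left this)

theorem amplitude_pos {μbar : Measure (EuclideanSpace ℝ (Fin d))} (hprob : IsProbabilityMeasure μbar)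
    (hdens : μbar = volume.withDensity (fun x => ENNReal.ofReal (parabolicDensity A ρ x))) :
    0 < A := by
  by_contra! hA
  have h0 : (fun x : EuclideanSpace ℝ (Fin d) => ENNReal.ofReal (parabolicDensity A ρ x))
      = fun _ => 0 := by
    funext x
    exact ENNReal.ofReal_of_nonpos (mul_nonpos_of_nonpos_of_nonneg hA (le_max_right _ _))
  rw [h0] at hdens
  have := hprob.measure_univ
  simp [hdens] at this

theorem measurable_ofReal_parabolicDensity :
    Measurable (fun x : EuclideanSpace ℝ (Fin d) => ENNReal.ofReal (parabolicDensity A ρ x)) :=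
  continuous_parabolicDensity.measurable.ennreal_ofReal

/-- The support of the parabolic density is contained in every closed set carrying the measure. -/
theorem closedBall_subset_of_parabolicDensity (hA : 0 < A) (hρ : 0 < ρ)
    {Ω : Set (EuclideanSpace ℝ (Fin d))} (hΩ : IsClosed Ω)
    (h : volume.withDensity (fun x => ENNReal.ofReal (parabolicDensity A ρ x)) Ωᶜ = 0) :
    Metric.closedBall 0 ρ ⊆ Ω := by
  rw [withDensity_apply_eq_zero measurable_ofReal_parabolicDensity] at h
  -- The density is positive on the open ball, so the part of the ball outside `Ω` is Lebesgue-null;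
  -- being open, it is empty.
  have hempty : Metric.ball (0 : EuclideanSpace ℝ (Fin d)) ρ ∩ Ωᶜ = ∅ := by
    refine (Metric.isOpen_ball.inter hΩ.isOpen_compl).eq_empty_of_measure_zero
      (μ := volume) (measure_mono_null ?_ h)
    rintro x ⟨hx, hxΩ⟩
    refine ⟨?_, hxΩ⟩
    simpa using parabolicDensity_pos hA (by simpa using hx)
  rw [← closure_ball _ hρ.ne']
  refine closure_minimal (fun x hx => ?_) hΩ
  by_contra hxΩ
  exact (hempty ▸ (⟨hx, hxΩ⟩ : x ∈ Metric.ball 0 ρ ∩ Ωᶜ) : x ∈ (∅ : Set _))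

theorem withDensity_parabolicDensity_compl_closedBall (hρ : 0 ≤ ρ) :
    volume.withDensity (fun x => ENNReal.ofReal (parabolicDensity A ρ x))
      (Metric.closedBall (0 : EuclideanSpace ℝ (Fin d)) ρ)ᶜ = 0 := by
  rw [withDensity_apply_eq_zero measurable_ofReal_parabolicDensity]
  convert measure_empty (μ := (volume : Measure (EuclideanSpace ℝ (Fin d))))
  refine eq_empty_of_forall_notMem ?_
  rintro x ⟨hx, hxb⟩
  have : ρ ≤ ‖x‖ := by
    have : ¬ ‖x‖ ≤ ρ := by simpa using hxb
    exact (not_le.1 this).le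
  simp [parabolicDensity_eq_zero hρ this] at hx

theorem integral_withDensity_ofReal {u : EuclideanSpace ℝ (Fin d) → ℝ} (hu : Measurable u)
    (hu0 : ∀ x, 0 ≤ u x) (g : EuclideanSpace ℝ (Fin d) → ℝ) :
    ∫ x, g x ∂(volume.withDensity fun x => ENNReal.ofReal (u x)) = ∫ x, u x * g x := by
  rw [integral_withDensity_eq_integral_toReal_smul hu.ennreal_ofReal (by simp)]
  simp [ENNReal.toReal_ofReal, hu0]

end Density

/-! ### Push-forward by a homothety and change of variables. -/

section Homothety

variable {d : ℕ} {R : ℝ → ℝ} {t : ℝ}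

theorem homotheticCurve_eq_withDensity {u : EuclideanSpace ℝ (Fin d) → ℝ} (hu : Measurable u)
    (ht : 0 < R t) :
    homotheticCurve R (volume.withDensity fun x => ENNReal.ofReal (u x)) t
      = volume.withDensity (fun x => ENNReal.ofReal (homotheticDensity R u t x)) := by
  have hm : Measurable fun x : EuclideanSpace ℝ (Fin d) => R t • x := by fun_prop
  have hu' : Measurable fun x : EuclideanSpace ℝ (Fin d) => ENNReal.ofReal (u ((R t)⁻¹ • x)) :=
    (hu.comp (by fun_prop : Measurable fun x : EuclideanSpace ℝ (Fin d) =>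
      (R t)⁻¹ • x)).ennreal_ofReal
  have hpos : 0 < (R t ^ d)⁻¹ := by positivity
  ext s hs
  rw [homotheticCurve, Measure.map_apply hm hs, withDensity_apply _ (hm hs),
    withDensity_apply _ hs]
  have h1 : ∫⁻ x in (fun x : EuclideanSpace ℝ (Fin d) => R t • x) ⁻¹' s, ENNReal.ofReal (u x)
      = ∫⁻ x in s, ENNReal.ofReal (u ((R t)⁻¹ • x))
          ∂(volume.map fun x : EuclideanSpace ℝ (Fin d) => R t • x) := by
    rw [setLIntegral_map hs hu' hm]
    simp [smul_smul, ht.ne']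
  rw [h1, Measure.map_addHaar_smul _ ht.ne', Measure.restrict_smul, lintegral_smul_measure,
    finrank_euclideanSpace_fin, abs_of_pos hpos, smul_eq_mul,
    ← lintegral_const_mul _ hu']
  simp only [homotheticDensity, ENNReal.ofReal_mul hpos.le]

theorem integral_homotheticCurve (μbar : Measure (EuclideanSpace ℝ (Fin d)))
    {f : EuclideanSpace ℝ (Fin d) → ℝ} (hf : AEStronglyMeasurable f (homotheticCurve R μbar t)) :
    ∫ x, f x ∂(homotheticCurve R μbar t) = ∫ y, f (R t • y) ∂μbar :=
  integral_map (by fun_prop) hf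

theorem continuous_homotheticDensity {u : EuclideanSpace ℝ (Fin d) → ℝ} (hu : Continuous u) :
    Continuous (homotheticDensity R u t) := by
  unfold homotheticDensity
  fun_prop

theorem homotheticDensity_nonneg {u : EuclideanSpace ℝ (Fin d) → ℝ} (hu : ∀ x, 0 ≤ u x)
    (ht : 0 < R t) (x : EuclideanSpace ℝ (Fin d)) : 0 ≤ homotheticDensity R u t x :=
  mul_nonneg (by positivity) (hu _)

/-- A factor `R t ≤ 1` contracts the support, so the original radius `ρ` serves at all times. -/
theorem homotheticDensity_eq_zero {A ρ : ℝ} (hρ : 0 ≤ ρ) (ht : 0 < R t) (ht1 : R t ≤ 1)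
    {x : EuclideanSpace ℝ (Fin d)} (hx : ρ ≤ ‖x‖) :
    homotheticDensity R (parabolicDensity A ρ) t x = 0 := by
  rw [homotheticDensity, parabolicDensity_eq_zero hρ, mul_zero]
  rw [norm_smul, norm_inv, Real.norm_of_nonneg ht.le]
  calc ρ ≤ 1 * ‖x‖ := by simpa using hx
    _ ≤ _ := by gcongr; exact (one_le_inv₀ ht).2 ht1

/-- Change of variables `x = R(t) y`. -/
theorem integral_homotheticDensity_mul {u : EuclideanSpace ℝ (Fin d) → ℝ}
    (g : EuclideanSpace ℝ (Fin d) → ℝ) (ht : 0 < R t) :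
    ∫ x, homotheticDensity R u t x * g x = ∫ y, u y * g (R t • y) := by
  have h := Measure.integral_comp_smul volume (fun x => u ((R t)⁻¹ • x) * g x) (R t)
  have hpos : 0 < (R t ^ d)⁻¹ := by positivity
  simp only [smul_smul, inv_mul_cancel₀ ht.ne', one_smul, finrank_euclideanSpace_fin,
    abs_of_pos hpos, smul_eq_mul] at h
  rw [h, ← integral_const_mul]
  simp only [homotheticDensity, mul_assoc]

theorem integrable_of_continuous_of_compl_closedBall {F : Type*} [NormedAddCommGroup F]
    {ν : Measure (EuclideanSpace ℝ (Fin d))} [IsFiniteMeasure ν] {ρ : ℝ}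
    (hν : ν (Metric.closedBall 0 ρ)ᶜ = 0) {f : EuclideanSpace ℝ (Fin d) → F}
    (hf : Continuous f) : Integrable f ν := by
  have := (hf.continuousOn (s := Metric.closedBall 0 ρ)).integrableOn_compact (μ := ν)
    (isCompact_closedBall _ _)
  rwa [IntegrableOn, Measure.restrict_eq_self_of_ae_mem] at this
  exact mem_ae_iff.2 hν

end Homothety

/-! ### Regularity, positivity and sign properties of the scaling factor. -/

section Scaling

variable {R : ℝ → ℝ}

theorem hasDerivAt_of_mem_Ioo (hR : ContDiffOn ℝ 1 R (Icc 0 1)) {t : ℝ} (ht : t ∈ Ioo (0 : ℝ) 1) :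
    HasDerivAt R (derivWithin R (Icc 0 1) t) t :=
  ((hR.differentiableOn one_ne_zero t (Ioo_subset_Icc_self ht)).hasDerivWithinAt).hasDerivAt
    (Icc_mem_nhds ht.1 ht.2)

theorem continuousOn_derivWithin_Icc (hR : ContDiffOn ℝ 1 R (Icc 0 1)) :
    ContinuousOn (derivWithin R (Icc (0 : ℝ) 1)) (Icc 0 1) :=
  hR.continuousOn_derivWithin (uniqueDiffOn_Icc one_pos) le_rfl

theorem exists_lipschitz_of_contDiffOn (hR : ContDiffOn ℝ 1 R (Icc 0 1)) :
    ∃ L : ℝ≥0, LipschitzOnWith L R (Icc 0 1) := by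
  obtain ⟨C, hC⟩ := isCompact_Icc.exists_bound_of_continuousOn (continuousOn_derivWithin_Icc hR)
  refine ⟨C.toNNReal, (convex_Icc 0 1).lipschitzOnWith_of_nnnorm_derivWithin_le
    (hR.differentiableOn one_ne_zero) fun t ht => ?_⟩
  rw [← NNReal.coe_le_coe, coe_nnnorm]
  exact (hC t ht).trans (Real.le_coe_toNNReal C)

/-- A function vanishing on a subinterval has vanishing derivative there. -/
theorem not_eqOn_zero_Ioo (hR : ContDiffOn ℝ 1 R (Icc 0 1))
    (hRderiv : ∀ᵐ t ∂(volume.restrict (Icc (0 : ℝ) 1)), derivWithin R (Icc 0 1) t ≠ 0)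
    {a b : ℝ} (ha : 0 ≤ a) (hb : b ≤ 1) (hab : a < b) : ¬ ∀ t ∈ Ioo a b, R t = 0 := by
  intro h
  have hsub : Ioo a b ⊆ {t | ¬ (t ∈ Icc (0 : ℝ) 1 → derivWithin R (Icc 0 1) t ≠ 0)} := by
    intro t ht
    have ht' : t ∈ Ioo (0 : ℝ) 1 := ⟨ha.trans_lt ht.1, ht.2.trans_le hb⟩
    have h1 := hasDerivAt_of_mem_Ioo hR ht'
    have h2 : HasDerivAt R 0 t := (hasDerivAt_const t (0 : ℝ)).congr_of_eventuallyEq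
      (eventually_of_mem (Ioo_mem_nhds ht.1 ht.2) h)
    simp only [mem_ofPred_eq, not_forall, not_not]
    exact ⟨Ioo_subset_Icc_self ht', h1.unique h2⟩
  have h0 := measure_mono_null hsub (ae_iff.1 ((ae_restrict_iff' measurableSet_Icc).1 hRderiv))
  simp at h0
  linarith

/-- By monotonicity and `R ≥ 0`, a zero at an interior time would propagate to a whole interval on
one side of it, where `R'` would vanish. -/
theorem scaling_pos (hR : ContDiffOn ℝ 1 R (Icc 0 1)) (hRmaps : MapsTo R (Icc 0 1) (Icc 0 1))
    (hRmono : MonotoneOn R (Icc 0 1) ∨ AntitoneOn R (Icc 0 1))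
    (hRderiv : ∀ᵐ t ∂(volume.restrict (Icc (0 : ℝ) 1)), derivWithin R (Icc 0 1) t ≠ 0)
    {t : ℝ} (ht : t ∈ Ioo (0 : ℝ) 1) : 0 < R t := by
  have htI := Ioo_subset_Icc_self ht
  refine (hRmaps htI).1.lt_of_ne fun h0 => ?_
  rcases hRmono with hm | hm
  · refine not_eqOn_zero_Ioo hR hRderiv le_rfl ht.2.le ht.1 fun s hs => ?_
    have hsI : s ∈ Icc (0 : ℝ) 1 := ⟨hs.1.le, hs.2.le.trans ht.2.le⟩
    exact le_antisymm (h0 ▸ hm hsI htI hs.2.le) (hRmaps hsI).1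
  · refine not_eqOn_zero_Ioo hR hRderiv ht.1.le le_rfl ht.2 fun s hs => ?_
    have hsI : s ∈ Icc (0 : ℝ) 1 := ⟨ht.1.le.trans hs.1.le, hs.2.le⟩
    exact le_antisymm (h0 ▸ hm htI hsI hs.1.le) (hRmaps hsI).1

/-- Monotonicity is used here to replace the factor `|R'|` coming from `V^(1/2)` by the continuous,
linear expression `σ R'`. -/
theorem exists_sign_abs_derivWithin
    (hRmono : MonotoneOn R (Icc 0 1) ∨ AntitoneOn R (Icc 0 1)) :
    ∃ σ : ℝ, σ * σ = 1 ∧ ∀ t, |derivWithin R (Icc 0 1) t| = σ * derivWithin R (Icc 0 1) t := by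
  rcases hRmono with hm | hm
  · exact ⟨1, by norm_num, fun t => by rw [abs_of_nonneg hm.derivWithin_nonneg, one_mul]⟩
  · exact ⟨-1, by norm_num, fun t => by rw [abs_of_nonpos hm.derivWithin_nonpos, neg_one_mul]⟩

end Scaling

/-! ### Lipschitz continuity in the Wasserstein space. -/

section Curve

variable {d : ℕ} {R : ℝ → ℝ} {ρ : ℝ} {ν : Measure (EuclideanSpace ℝ (Fin d))}
  {Ω : Set (EuclideanSpace ℝ (Fin d))}

theorem ae_norm_le (hν : ν (Metric.closedBall 0 ρ)ᶜ = 0) : ∀ᵐ x ∂ν, ‖x‖ ≤ ρ := by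
  filter_upwards [mem_ae_iff.2 hν] with x hx
  simpa using hx

theorem homotheticCurve_compl_closedBall (hν : ν (Metric.closedBall 0 ρ)ᶜ = 0) {t : ℝ}
    (h0 : 0 ≤ R t) (h1 : R t ≤ 1) : homotheticCurve R ν t (Metric.closedBall 0 ρ)ᶜ = 0 := by
  rw [homotheticCurve, Measure.map_apply (by fun_prop) Metric.isClosed_closedBall.measurableSet.compl]
  refine measure_mono_null (t := (Metric.closedBall 0 ρ)ᶜ) (fun x hx hxb => hx ?_) hν
  rw [mem_closedBall_zero_iff] at hxb ⊢
  rw [norm_smul, Real.norm_of_nonneg h0]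
  exact (mul_le_of_le_one_left (norm_nonneg x) h1).trans hxb

theorem isProbabilityMeasure_homotheticCurve [IsProbabilityMeasure ν] (t : ℝ) :
    IsProbabilityMeasure (homotheticCurve R ν t) :=
  Measure.isProbabilityMeasure_map (by fun_prop)

theorem memWasserstein_of_compl_closedBall (hprob : IsProbabilityMeasure ν)
    (hν : ν (Metric.closedBall 0 ρ)ᶜ = 0) (hΩ : Metric.closedBall 0 ρ ⊆ Ω) :
    MemWasserstein Ω 2 ν where
  prob := hprob
  concentrated := measure_mono_null (compl_subset_compl.2 hΩ) hν
  moment := by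
    calc ∫⁻ x, ‖x‖ₑ ^ (2 : ℝ) ∂ν ≤ ∫⁻ _, ENNReal.ofReal ρ ^ (2 : ℝ) ∂ν := by
          refine lintegral_mono_ae ?_
          filter_upwards [ae_norm_le hν] with x hx
          gcongr
          rw [← ofReal_norm]
          exact ENNReal.ofReal_le_ofReal hx
      _ < ⊤ := by simp

theorem isLipschitzCurve_homotheticCurve [hprob : IsProbabilityMeasure ν]
    (hν : ν (Metric.closedBall 0 ρ)ᶜ = 0) (hΩ : Metric.closedBall 0 ρ ⊆ Ω)
    (hR : ContDiffOn ℝ 1 R (Icc 0 1)) (hRmaps : MapsTo R (Icc 0 1) (Icc 0 1)) :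
    IsLipschitzCurve Ω 2 (homotheticCurve R ν) where
  mem t ht := memWasserstein_of_compl_closedBall (isProbabilityMeasure_homotheticCurve t)
    (homotheticCurve_compl_closedBall hν (hRmaps ht).1 (hRmaps ht).2) hΩ
  lipschitz := by
    obtain ⟨L, hL⟩ := exists_lipschitz_of_contDiffOn hR
    -- The plan `x ↦ (R(s) x, R(t) x)` moves each point by `|R(s) - R(t)| |x|`, with `|x| ≤ ρ`
    -- almost everywhere.
    refine ⟨L * ρ.toNNReal, fun s hs t ht => ?_⟩
    have hm : Measurable fun x : EuclideanSpace ℝ (Fin d) => (R s • x, R t • x) := by fun_prop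
    have hmem : ν.map (fun x => (R s • x, R t • x)) ∈
        couplings (homotheticCurve R ν s) (homotheticCurve R ν t) :=
      ⟨by rw [Measure.map_map measurable_fst hm]; rfl,
        by rw [Measure.map_map measurable_snd hm]; rfl⟩
    have hcost : ∫⁻ z, edist z.1 z.2 ^ (2 : ℝ) ∂(ν.map fun x => (R s • x, R t • x)) ≤
        ((L * ρ.toNNReal : ℝ≥0) * edist s t) ^ (2 : ℝ) := by
      rw [lintegral_map (by fun_prop) hm]
      calc _ ≤ ∫⁻ _, ((L * ρ.toNNReal : ℝ≥0) * edist s t) ^ (2 : ℝ) ∂ν := by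
            refine lintegral_mono_ae ?_
            filter_upwards [ae_norm_le hν] with x hx
            gcongr
            have h1 : edist (R s • x) (R t • x) = edist (R s) (R t) * ‖x‖ₑ := by
              rw [edist_eq_enorm_sub, edist_eq_enorm_sub, ← sub_smul, enorm_smul]
            have h2 : ‖x‖ₑ ≤ (ρ.toNNReal : ℝ≥0∞) := by
              rw [← ofReal_norm]
              exact ENNReal.ofReal_le_ofReal hx
            rw [h1, ENNReal.coe_mul, mul_right_comm]
            gcongr
            exact hL hs ht
        _ = _ := by simp
    calc wassersteinDist 2 (homotheticCurve R ν s) (homotheticCurve R ν t)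
        ≤ (((L * ρ.toNNReal : ℝ≥0) * edist s t) ^ (2 : ℝ)) ^ (1 / (2 : ℝ)) := by
          refine ENNReal.rpow_le_rpow ((iInf₂_le _ hmem).trans hcost) (by norm_num)
      _ = (L * ρ.toNNReal : ℝ≥0) * edist s t := by
          rw [← ENNReal.rpow_mul]
          norm_num

end Curve

/-! ### Integrals depending on time against a measure carried by a ball. -/

section ParametricIntegral

variable {d : ℕ} {ρ a b : ℝ} {ν : Measure (EuclideanSpace ℝ (Fin d))}
  {g g' : ℝ → EuclideanSpace ℝ (Fin d) → ℝ}

theorem exists_ae_bound_of_continuousOn (hν : ν (Metric.closedBall 0 ρ)ᶜ = 0)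
    (hg : ContinuousOn (fun z : ℝ × EuclideanSpace ℝ (Fin d) => g z.1 z.2) (Icc a b ×ˢ univ)) :
    ∃ C : ℝ, ∀ᵐ y ∂ν, ∀ s ∈ Icc a b, ‖g s y‖ ≤ C := by
  obtain ⟨C, hC⟩ := (isCompact_Icc.prod
    (isCompact_closedBall (0 : EuclideanSpace ℝ (Fin d)) ρ)).exists_bound_of_continuousOn
    (hg.mono (prod_mono_right (subset_univ _)))
  refine ⟨C, ?_⟩
  filter_upwards [ae_norm_le hν] with y hy s hs
  exact hC (s, y) ⟨hs, by simpa using hy⟩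

theorem continuous_section_of_continuousOn
    (hg : ContinuousOn (fun z : ℝ × EuclideanSpace ℝ (Fin d) => g z.1 z.2) (Icc a b ×ˢ univ))
    {s : ℝ} (hs : s ∈ Icc a b) : Continuous (g s) :=
  hg.comp_continuous (f := fun y => (s, y)) (by fun_prop) fun _ => ⟨hs, mem_univ _⟩

/-- The measure is finite and carried by a compact ball, so on a compact time interval a constant
dominates the integrand. -/
theorem continuousOn_integral_of_compl_closedBall [IsFiniteMeasure ν]
    (hν : ν (Metric.closedBall 0 ρ)ᶜ = 0)
    (hg : ContinuousOn (fun z : ℝ × EuclideanSpace ℝ (Fin d) => g z.1 z.2) (Icc a b ×ˢ univ)) :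
    ContinuousOn (fun s => ∫ y, g s y ∂ν) (Icc a b) := by
  obtain ⟨C, hC⟩ := exists_ae_bound_of_continuousOn hν hg
  refine continuousOn_of_dominated (bound := fun _ => C)
    (fun s hs => (continuous_section_of_continuousOn hg hs).aestronglyMeasurable)
    (fun s hs => hC.mono fun y hy => hy s hs) (integrable_const C) (ae_of_all _ fun y => ?_)
  exact hg.comp (f := fun s => (s, y)) (by fun_prop) fun s hs => ⟨hs, mem_univ _⟩

/-- Fundamental theorem of calculus under the integral sign. -/
theorem intervalIntegral_integral_eq_sub [IsFiniteMeasure ν]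
    (hν : ν (Metric.closedBall 0 ρ)ᶜ = 0) (hab : a ≤ b)
    (hg : ContinuousOn (fun z : ℝ × EuclideanSpace ℝ (Fin d) => g z.1 z.2) (Icc a b ×ˢ univ))
    (hg' : ContinuousOn (fun z : ℝ × EuclideanSpace ℝ (Fin d) => g' z.1 z.2) (Icc a b ×ˢ univ))
    (hderiv : ∀ s ∈ Ioo a b, ∀ y, HasDerivAt (fun r => g r y) (g' s y) s) :
    IntervalIntegrable (fun s => ∫ y, g' s y ∂ν) volume a b ∧
      ∫ s in a..b, ∫ y, g' s y ∂ν = ∫ y, g b y ∂ν - ∫ y, g a y ∂ν := by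
  have hint : IntervalIntegrable (fun s => ∫ y, g' s y ∂ν) volume a b :=
    ContinuousOn.intervalIntegrable_of_Icc hab (continuousOn_integral_of_compl_closedBall hν hg')
  refine ⟨hint, intervalIntegral.integral_eq_sub_of_hasDerivAt_of_le hab
    (continuousOn_integral_of_compl_closedBall hν hg) (fun s hs => ?_) hint⟩
  obtain ⟨C, hC⟩ := exists_ae_bound_of_continuousOn hν hg'
  have hsI := Ioo_subset_Icc_self hs
  refine (hasDerivAt_integral_of_dominated_loc_of_deriv_le (bound := fun _ => C)
    (Ioo_mem_nhds hs.1 hs.2) ?_ ?_ ?_ ?_ (integrable_const C) ?_).2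
  · filter_upwards [Ioo_mem_nhds hs.1 hs.2] with r hr
    exact (continuous_section_of_continuousOn hg
      (Ioo_subset_Icc_self hr)).aestronglyMeasurable
  · exact integrable_of_continuous_of_compl_closedBall hν (continuous_section_of_continuousOn hg hsI)
  · exact (continuous_section_of_continuousOn hg' hsI).aestronglyMeasurable
  · exact hC.mono fun y hy r hr => hy r (Ioo_subset_Icc_self hr)
  · exact ae_of_all _ fun y r hr => hderiv r hr y

end ParametricIntegral

/-! ### The homothetic field is a velocity field. -/

section Velocity

variable {d : ℕ} {R : ℝ → ℝ} {ρ : ℝ} {ν : Measure (EuclideanSpace ℝ (Fin d))}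
  {Ω : Set (EuclideanSpace ℝ (Fin d))}

theorem homotheticField_smul {t : ℝ} (ht : 0 < R t) (y : EuclideanSpace ℝ (Fin d)) :
    homotheticField R t (R t • y) = derivWithin R (Icc 0 1) t • y := by
  rw [homotheticField, smul_smul, div_mul_cancel₀ _ ht.ne']

theorem continuous_homotheticField (t : ℝ) :
    Continuous (homotheticField R t : EuclideanSpace ℝ (Fin d) → EuclideanSpace ℝ (Fin d)) := by
  unfold homotheticField
  fun_prop

/-- The Lagrangian form contains no division by `R`, so it stays continuous up to an endpoint where
`R` vanishes. -/
theorem integral_fderiv_homotheticField {φ : EuclideanSpace ℝ (Fin d) → ℝ} (hφ : ContDiff ℝ 1 φ)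
    {t : ℝ} (ht : 0 < R t) :
    ∫ x, fderiv ℝ φ x (homotheticField R t x) ∂(homotheticCurve R ν t) =
      ∫ y, fderiv ℝ φ (R t • y) (derivWithin R (Icc 0 1) t • y) ∂ν := by
  have hc : Continuous fun x => fderiv ℝ φ x (homotheticField R t x) :=
    (hφ.continuous_fderiv one_ne_zero).clm_apply (continuous_homotheticField t)
  rw [integral_homotheticCurve _ hc.aestronglyMeasurable]
  simp only [homotheticField_smul ht]

theorem measurable_domRestrict_homotheticField (hR : ContDiffOn ℝ 1 R (Icc 0 1)) :
    Measurable ((Icc (0 : ℝ) 1 ×ˢ Ω).domRestrict (fun z => homotheticField R z.1 z.2)) := by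
  have h1 : Continuous fun z : ↥(Icc (0 : ℝ) 1 ×ˢ Ω) => derivWithin R (Icc 0 1) z.1.1 :=
    (continuousOn_derivWithin_Icc hR).comp_continuous (by fun_prop) fun z => z.2.1
  have h2 : Continuous fun z : ↥(Icc (0 : ℝ) 1 ×ˢ Ω) => R z.1.1 :=
    hR.continuousOn.comp_continuous (by fun_prop) fun z => z.2.1
  have h3 : Measurable fun z : ↥(Icc (0 : ℝ) 1 ×ˢ Ω) => z.1.2 := by fun_prop
  exact (h1.measurable.div h2.measurable).smul h3

theorem isVelocityField_homotheticField [hprob : IsProbabilityMeasure ν]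
    (hν : ν (Metric.closedBall 0 ρ)ᶜ = 0)
    (hR : ContDiffOn ℝ 1 R (Icc 0 1)) (hRmaps : MapsTo R (Icc 0 1) (Icc 0 1))
    (hpos : ∀ t ∈ Ioo (0 : ℝ) 1, 0 < R t) :
    IsVelocityField Ω 2 (homotheticCurve R ν) (homotheticField R) where
  measurable := measurable_domRestrict_homotheticField hR
  memLp := by
    filter_upwards [ae_restrict_mem measurableSet_Icc] with t ht
    have := isProbabilityMeasure_homotheticCurve (R := R) (ν := ν) t
    have hsupp := homotheticCurve_compl_closedBall hν (hRmaps ht).1 (hRmaps ht).2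
    obtain ⟨C, hC⟩ := (isCompact_closedBall (0 : EuclideanSpace ℝ (Fin d))
      ρ).exists_bound_of_continuousOn (continuous_homotheticField (R := R) t).continuousOn
    refine MemLp.of_bound (continuous_homotheticField t).aestronglyMeasurable C ?_
    filter_upwards [mem_ae_iff.2 hsupp] with x hx
    exact hC x hx
  continuity φ hφ _ t₁ ht₁ t₂ ht₂ h12 := by
    have hsub : Icc t₁ t₂ ⊆ Icc 0 1 := Icc_subset_Icc ht₁.1 ht₂.2
    have hsub' : Ioo t₁ t₂ ⊆ Ioo 0 1 := Ioo_subset_Ioo ht₁.1 ht₂.2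
    have hcR : ContinuousOn (fun z : ℝ × EuclideanSpace ℝ (Fin d) => R z.1 • z.2)
        (Icc t₁ t₂ ×ˢ univ) :=
      (hR.continuousOn.comp continuousOn_fst fun z hz => hsub hz.1).smul continuousOn_snd
    have hcR' : ContinuousOn
        (fun z : ℝ × EuclideanSpace ℝ (Fin d) => derivWithin R (Icc 0 1) z.1 • z.2)
        (Icc t₁ t₂ ×ˢ univ) :=
      ((continuousOn_derivWithin_Icc hR).comp continuousOn_fst fun z hz => hsub hz.1).smul
        continuousOn_snd
    obtain ⟨hint, heq⟩ := intervalIntegral_integral_eq_sub (ν := ν)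
      (g := fun s y => φ (R s • y))
      (g' := fun s y => fderiv ℝ φ (R s • y) (derivWithin R (Icc 0 1) s • y)) hν h12.le
      (hφ.continuous.comp_continuousOn hcR)
      (((hφ.continuous_fderiv one_ne_zero).comp_continuousOn hcR).clm_apply hcR')
      (fun s hs y => ((hφ.differentiable one_ne_zero _).hasFDerivAt).comp_hasDerivAt s
        ((hasDerivAt_of_mem_Ioo hR (hsub' hs)).smul_const y))
    -- Only open intervals are allowed: at an endpoint with `R = 0` the quotient `R'/R` is `0` by
    -- convention, and the two integrals may differ. Such a time is negligible.
    have hcongr : EqOn (fun s => ∫ y, fderiv ℝ φ (R s • y) (derivWithin R (Icc 0 1) s • y) ∂ν)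
        (fun s => ∫ x, fderiv ℝ φ x (homotheticField R s x) ∂(homotheticCurve R ν s))
        (Ioo t₁ t₂) := fun s hs => (integral_fderiv_homotheticField hφ (hpos s (hsub' hs))).symm
    have hae : ∀ᵐ s, s ∈ uIoc t₁ t₂ →
        ∫ y, fderiv ℝ φ (R s • y) (derivWithin R (Icc 0 1) s • y) ∂ν =
        ∫ x, fderiv ℝ φ x (homotheticField R s x) ∂(homotheticCurve R ν s) := by
      filter_upwards [compl_mem_ae_iff.2 (measure_singleton t₂)] with s hs hs'
      rw [uIoc_of_le h12.le] at hs'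
      exact hcongr ⟨hs'.1, hs'.2.lt_of_ne hs⟩
    refine ⟨hint.congr_ae ((ae_restrict_iff' measurableSet_uIoc).2 hae), ?_⟩
    rw [← intervalIntegral.integral_congr_ae hae, heq,
      integral_homotheticCurve _ hφ.continuous.aestronglyMeasurable,
      integral_homotheticCurve _ hφ.continuous.aestronglyMeasurable]

end Velocity

/-! ### Minimality of the norm. -/

section Tangent

variable {d : ℕ} {R : ℝ → ℝ} {ρ : ℝ} {ν : Measure (EuclideanSpace ℝ (Fin d))}
  {Ω : Set (EuclideanSpace ℝ (Fin d))}

/-- Cauchy–Schwarz: the hypothesis says that `g - f` is orthogonal to `f`. -/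
theorem eLpNorm_two_le_of_integral_inner_eq {α F : Type*} [MeasurableSpace α] {μ : Measure α}
    [NormedAddCommGroup F] [InnerProductSpace ℝ F] {f g : α → F} (hf : MemLp f 2 μ)
    (hg : MemLp g 2 μ) (h : ∫ x, inner ℝ (f x) (g x) ∂μ = ∫ x, inner ℝ (f x) (f x) ∂μ) :
    eLpNorm f 2 μ ≤ eLpNorm g 2 μ := by
  have h1 : inner ℝ (hf.toLp f) (hg.toLp g) = inner ℝ (hf.toLp f) (hf.toLp f) := by
    rw [L2.inner_def, L2.inner_def]
    calc _ = ∫ x, inner ℝ (f x) (g x) ∂μ := integral_congr_ae (by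
            filter_upwards [hf.coeFn_toLp, hg.coeFn_toLp] with x hx hy
            rw [hx, hy])
      _ = _ := h
      _ = _ := integral_congr_ae (by
            filter_upwards [hf.coeFn_toLp] with x hx
            rw [hx])
  have h2 : ‖hf.toLp f‖ ≤ ‖hg.toLp g‖ := by
    have h3 := real_inner_le_norm (hf.toLp f) (hg.toLp g)
    rw [h1, real_inner_self_eq_norm_mul_norm] at h3
    rcases (norm_nonneg (hf.toLp f)).eq_or_lt with h0 | h0
    · rw [← h0]
      exact norm_nonneg _
    · exact le_of_mul_le_mul_left h3 h0
  rw [Lp.norm_toLp, Lp.norm_toLp] at h2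
  exact (ENNReal.toReal_le_toReal hf.eLpNorm_ne_top hg.eLpNorm_ne_top).1 h2

/-- Lebesgue differentiation of the two equal primitives. -/
theorem ae_eq_of_forall_intervalIntegral_eq {f g : ℝ → ℝ}
    (hf : IntervalIntegrable f volume 0 1) (hg : IntervalIntegrable g volume 0 1)
    (h : ∀ t ∈ Ioo (0 : ℝ) 1, ∫ s in (0 : ℝ)..t, f s = ∫ s in (0 : ℝ)..t, g s) :
    ∀ᵐ t, t ∈ Ioo (0 : ℝ) 1 → f t = g t := by
  filter_upwards [hf.ae_hasDerivAt_integral, hg.ae_hasDerivAt_integral] with t hft hgt ht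
  have htI : t ∈ uIcc (0 : ℝ) 1 := by
    rw [uIcc_of_le zero_le_one]
    exact Ioo_subset_Icc_self ht
  refine (hft htI 0 left_mem_uIcc).unique
    ((hgt htI 0 left_mem_uIcc).congr_of_eventuallyEq ?_)
  filter_upwards [Ioo_mem_nhds ht.1 ht.2] with s hs using h s hs

/-- A compactly supported smooth function equal to `‖x‖² / 2` near a given ball. -/
theorem exists_compactSupport_eq_half_norm_sq (hρ : 0 < ρ) :
    ∃ φ : EuclideanSpace ℝ (Fin d) → ℝ, ContDiff ℝ 1 φ ∧ HasCompactSupport φ ∧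
      ∀ x, ‖x‖ ≤ ρ → ∀ w, fderiv ℝ φ x w = inner ℝ x w := by
  -- The inner radius exceeds `ρ`, so the cutoff is `1` near every point of the closed ball and does
  -- not affect the derivative there.
  let χ : ContDiffBump (0 : EuclideanSpace ℝ (Fin d)) := ⟨ρ + 1, ρ + 2, by linarith, by linarith⟩
  refine ⟨fun x => χ x * ((1 / 2) * ‖x‖ ^ 2), χ.contDiff.mul (contDiff_const.mul
    (contDiff_norm_sq ℝ)), χ.hasCompactSupport.mul_right, fun x hx w => ?_⟩
  have hev : (fun x => χ x * ((1 / 2) * ‖x‖ ^ 2)) =ᶠ[𝓝 x] fun x => (1 / 2) * ‖x‖ ^ 2 := by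
    filter_upwards [Metric.isOpen_ball.mem_nhds
      (show x ∈ Metric.ball (0 : EuclideanSpace ℝ (Fin d)) (ρ + 1) by
        rw [mem_ball_zero_iff]
        linarith)] with y hy
    rw [χ.one_of_mem_closedBall (Metric.ball_subset_closedBall hy), one_mul]
  have hd : HasFDerivAt (fun x : EuclideanSpace ℝ (Fin d) => (1 / 2 : ℝ) * ‖x‖ ^ 2)
      ((1 / 2 : ℝ) • (2 • innerSL ℝ x)) x :=
    (hasStrictFDerivAt_norm_sq x).hasFDerivAt.const_mul (1 / 2 : ℝ)
  rw [hev.fderiv_eq, hd.fderiv]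
  simp

/-- One test function suffices, the truncated `|x|²/2`, because `v_t` is a scalar multiple of its
gradient on the ball. The exceptional null set of times then concerns this function alone. -/
theorem isTangentField_homotheticField [hprob : IsProbabilityMeasure ν] (hρ : 0 < ρ)
    (hν : ν (Metric.closedBall 0 ρ)ᶜ = 0)
    (hR : ContDiffOn ℝ 1 R (Icc 0 1)) (hRmaps : MapsTo R (Icc 0 1) (Icc 0 1))
    (hpos : ∀ t ∈ Ioo (0 : ℝ) 1, 0 < R t) :
    IsTangentField Ω 2 (homotheticCurve R ν) (homotheticField R) where
  velocity := isVelocityField_homotheticField hν hR hRmaps hpos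
  minimal w hw := by
    have hv : IsVelocityField Ω 2 (homotheticCurve R ν) (homotheticField R) :=
      isVelocityField_homotheticField hν hR hRmaps hpos
    obtain ⟨φ, hφ, hφc, hφd⟩ := exists_compactSupport_eq_half_norm_sq (d := d) hρ
    have h0 : (0 : ℝ) ∈ Icc (0 : ℝ) 1 := left_mem_Icc.2 zero_le_one
    have h1 : (1 : ℝ) ∈ Icc (0 : ℝ) 1 := right_mem_Icc.2 zero_le_one
    have hae := ae_eq_of_forall_intervalIntegral_eq
      (hw.continuity φ hφ hφc 0 h0 1 h1 one_pos).1 (hv.continuity φ hφ hφc 0 h0 1 h1 one_pos).1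
      fun t ht => by
        rw [← (hw.continuity φ hφ hφc 0 h0 t (Ioo_subset_Icc_self ht) ht.1).2,
          (hv.continuity φ hφ hφc 0 h0 t (Ioo_subset_Icc_self ht) ht.1).2]
    have hmw := hw.memLp
    have hmv := hv.memLp
    rw [← restrict_Ioo_eq_restrict_Icc] at hmw hmv ⊢
    filter_upwards [hmw, hmv, ae_restrict_mem measurableSet_Ioo, ae_restrict_of_ae hae]
      with t hwt hvt ht heq
    have htI := Ioo_subset_Icc_self ht
    have hsupp : ∀ᵐ x ∂(homotheticCurve R ν t), ‖x‖ ≤ ρ :=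
      ae_norm_le (homotheticCurve_compl_closedBall hν (hRmaps htI).1 (hRmaps htI).2)
    rw [ENNReal.ofReal_ofNat] at hwt hvt ⊢
    have key : ∫ x, inner ℝ x (w t x) ∂(homotheticCurve R ν t)
        = ∫ x, inner ℝ x (homotheticField R t x) ∂(homotheticCurve R ν t) := by
      calc _ = _ := integral_congr_ae (hsupp.mono fun x hx => (hφd x hx _).symm)
        _ = _ := heq ht
        _ = _ := integral_congr_ae (hsupp.mono fun x hx => hφd x hx _)
    refine eLpNorm_two_le_of_integral_inner_eq hvt hwt ?_
    have hin : ∀ x z : EuclideanSpace ℝ (Fin d), inner ℝ (homotheticField R t x) z =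
        (derivWithin R (Icc (0 : ℝ) 1) t / R t) * inner ℝ x z := fun x z => by
      rw [homotheticField, real_inner_smul_left]
    simp only [hin]
    rw [integral_const_mul, integral_const_mul, key]

end Tangent

/-! ### The identity linking the gradient of the squared profile to the position vector. -/

section Divergence

variable {d : ℕ} {A ρ : ℝ}

/-- The positive part has a corner at `0`, but its square does not; hence `ū²` is differentiable
across the sphere of radius `ρ`. -/
theorem hasDerivAt_max_zero_sq (s : ℝ) :
    HasDerivAt (fun r : ℝ => max r 0 ^ 2) (2 * max s 0) s := by
  rcases lt_trichotomy s 0 with hs | rfl | hs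
  · have : (fun r : ℝ => max r 0 ^ 2) =ᶠ[𝓝 s] fun _ => 0 := by
      filter_upwards [Iio_mem_nhds hs] with r hr
      simp [max_eq_right (mem_Iio.1 hr).le]
    rw [max_eq_right hs.le, mul_zero]
    exact (hasDerivAt_const s (0 : ℝ)).congr_of_eventuallyEq this
  · rw [max_self, mul_zero, hasDerivAt_iff_isLittleO]
    simp only [max_self, sub_zero, smul_eq_mul, mul_zero, ne_eq, OfNat.ofNat_ne_zero,
      not_false_eq_true, zero_pow]
    have h1 : (fun r : ℝ => max r 0 ^ 2) =O[𝓝 0] fun r : ℝ => r ^ 2 := by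
      refine Asymptotics.isBigO_of_le _ fun r => ?_
      rcases le_total r 0 with h | h <;> simp [h, sq_nonneg]
    exact h1.trans_isLittleO (Asymptotics.isLittleO_pow_id one_lt_two)
  · have : (fun r : ℝ => max r 0 ^ 2) =ᶠ[𝓝 s] fun r => r ^ 2 := by
      filter_upwards [Ioi_mem_nhds hs] with r hr
      simp [max_eq_left (mem_Ioi.1 hr).le]
    rw [max_eq_left hs.le]
    simpa using (hasDerivAt_pow 2 s).congr_of_eventuallyEq this

theorem hasFDerivAt_parabolicDensity_sq (x : EuclideanSpace ℝ (Fin d)) :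
    HasFDerivAt (fun y => parabolicDensity A ρ y ^ 2)
      ((-(4 * A * parabolicDensity A ρ x)) • innerSL ℝ x) x := by
  have h1 : HasFDerivAt (fun y : EuclideanSpace ℝ (Fin d) => ρ ^ 2 - ‖y‖ ^ 2)
      (-(2 • innerSL ℝ x)) x := (hasStrictFDerivAt_norm_sq x).hasFDerivAt.const_sub (ρ ^ 2)
  have h2 := ((hasDerivAt_max_zero_sq (ρ ^ 2 - ‖x‖ ^ 2)).comp_hasFDerivAt x h1).const_mul (A ^ 2)
  have h3 : (fun y : EuclideanSpace ℝ (Fin d) => parabolicDensity A ρ y ^ 2)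
      = fun y => A ^ 2 * ((fun r : ℝ => max r 0 ^ 2) ∘ fun y => ρ ^ 2 - ‖y‖ ^ 2) y := by
    funext y
    simp only [parabolicDensity, Function.comp_apply, mul_pow]
  rw [h3]
  refine h2.congr_fderiv ?_
  ext w
  simp [parabolicDensity]
  ring

theorem hasCompactSupport_parabolicDensity (hρ : 0 ≤ ρ) :
    HasCompactSupport (parabolicDensity A ρ : EuclideanSpace ℝ (Fin d) → ℝ) := by
  refine HasCompactSupport.intro (isCompact_closedBall 0 ρ) fun x hx => ?_
  rw [mem_closedBall_zero_iff, not_le] at hx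
  exact parabolicDensity_eq_zero hρ hx.le

theorem integrable_parabolicDensity_mul_of_continuous (hρ : 0 ≤ ρ)
    {f : EuclideanSpace ℝ (Fin d) → ℝ} (hf : Continuous f) :
    Integrable fun y => parabolicDensity A ρ y * f y :=
  (continuous_parabolicDensity.mul hf).integrable_of_hasCompactSupport
    (hasCompactSupport_parabolicDensity hρ).mul_right

/-- The identity `∇(ū²) = -4 A ū x`, in weak form. -/
theorem integral_parabolicDensity_sq_mul_div (hρ : 0 ≤ ρ)
    {η : EuclideanSpace ℝ (Fin d) → EuclideanSpace ℝ (Fin d)} (hη : ContDiff ℝ 1 η) :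
    ∫ y, parabolicDensity A ρ y ^ 2 * ∑ i, (fderiv ℝ η y (EuclideanSpace.single i 1)) i
      = 4 * A * ∫ y, parabolicDensity A ρ y * inner ℝ y (η y) := by
  have hcoord : ∀ i y w, fderiv ℝ (fun z => η z i) y w = (fderiv ℝ η y w) i := fun i y w => by
    have h := (EuclideanSpace.proj (𝕜 := ℝ) i).hasFDerivAt.comp y
      (hη.differentiable one_ne_zero y).hasFDerivAt
    have h' : HasFDerivAt (fun z => η z i)
        ((EuclideanSpace.proj (𝕜 := ℝ) i).comp (fderiv ℝ η y)) y := h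
    rw [h'.fderiv]
    rfl
  have hci : ∀ i, Continuous fun y => η y i := fun i =>
    (EuclideanSpace.proj (𝕜 := ℝ) i).continuous.comp hη.continuous
  have hcd : ∀ i, Continuous fun y => (fderiv ℝ η y (EuclideanSpace.single i 1)) i := fun i =>
    (EuclideanSpace.proj (𝕜 := ℝ) i).continuous.comp
      ((hη.continuous_fderiv one_ne_zero).clm_apply continuous_const)
  have hcp := continuous_parabolicDensity (d := d) (A := A) (ρ := ρ)
  have hcy : ∀ i, Continuous fun y : EuclideanSpace ℝ (Fin d) => y i := fun i =>
    (EuclideanSpace.proj (𝕜 := ℝ) i).continuous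
  have hint1 : ∀ i, Integrable fun y => parabolicDensity A ρ y ^ 2 *
      (fderiv ℝ η y (EuclideanSpace.single i 1)) i := fun i => by
    refine (integrable_parabolicDensity_mul_of_continuous (A := A) hρ
      (hcp.mul (hcd i))).congr (ae_of_all _ fun y => ?_)
    simp only [Pi.mul_apply]
    ring
  have hint2 : ∀ i, Integrable fun y => parabolicDensity A ρ y * (y i * η y i) := fun i =>
    integrable_parabolicDensity_mul_of_continuous hρ ((hcy i).mul (hci i))
  have hfd : ∀ i (y : EuclideanSpace ℝ (Fin d)), fderiv ℝ (fun z => parabolicDensity A ρ z ^ 2) y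
      (EuclideanSpace.single i 1) = -(4 * A) * (parabolicDensity A ρ y * y i) := fun i y => by
    rw [(hasFDerivAt_parabolicDensity_sq y).fderiv]
    simp only [smul_apply, innerSL_apply_apply, smul_eq_mul,
      EuclideanSpace.inner_single_right]
    simp
    ring
  have hi : ∀ i, ∫ y, parabolicDensity A ρ y ^ 2 * (fderiv ℝ η y (EuclideanSpace.single i 1)) i
      = 4 * A * ∫ y, parabolicDensity A ρ y * (y i * η y i) := fun i => by
    -- Integration by parts in each coordinate; compact support of `ū` gives the integrability
    -- required and leaves no boundary term.
    have h := integral_mul_fderiv_eq_neg_fderiv_mul_of_integrable (μ := volume)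
      (f := fun y => parabolicDensity A ρ y ^ 2) (g := fun y => η y i)
      (v := EuclideanSpace.single i 1) ?_ ?_ ?_ ?_ ?_
    · simp only [hcoord, hfd] at h
      rw [h, ← integral_const_mul, ← integral_neg]
      refine integral_congr_ae (ae_of_all _ fun y => ?_)
      ring
    · simp only [hfd]
      refine ((hint2 i).const_mul (-(4 * A))).congr (ae_of_all _ fun y => ?_)
      simp only
      ring
    · simpa only [hcoord] using hint1 i
    · refine (integrable_parabolicDensity_mul_of_continuous (A := A) hρ
        (hcp.mul (hci i))).congr (ae_of_all _ fun y => ?_)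
      simp only [Pi.mul_apply]
      ring
    · exact fun y _ => (hasFDerivAt_parabolicDensity_sq y).differentiableAt
    · exact fun y _ => ((EuclideanSpace.proj (𝕜 := ℝ) i).differentiableAt).comp y
        (hη.differentiable one_ne_zero y)
  simp only [Finset.mul_sum]
  rw [integral_finsetSum _ fun i _ => hint1 i]
  simp only [hi]
  rw [← Finset.mul_sum, ← integral_finsetSum _ fun i _ => hint2 i]
  congr 1
  refine integral_congr_ae (ae_of_all _ fun y => ?_)
  simp only [← Finset.mul_sum, PiLp.inner_apply, RCLike.inner_apply, conj_trivial]
  congr 1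
  exact Finset.sum_congr rfl fun i _ => mul_comm _ _

/-- The preceding identity for the field `η(y) = y`, of divergence `d`. This relation balances the
constants of the momentum equation. -/
theorem dim_mul_integral_parabolicDensity_sq (hρ : 0 ≤ ρ) :
    d * ∫ y : EuclideanSpace ℝ (Fin d), parabolicDensity A ρ y ^ 2
      = 4 * A * ∫ y : EuclideanSpace ℝ (Fin d), parabolicDensity A ρ y * ‖y‖ ^ 2 := by
  have h := integral_parabolicDensity_sq_mul_div (d := d) (A := A) hρ (η := fun y => y) contDiff_id
  simp only [fderiv_fun_id, real_inner_self_eq_norm_sq] at h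
  rw [← h, ← integral_const_mul]
  refine integral_congr_ae (ae_of_all _ fun y => ?_)
  simp [mul_comm]

/-- The integrand is continuous, nonnegative and positive at a point of norm `ρ/2`, which exists
because `d ≥ 1`. -/
theorem integral_parabolicDensity_mul_norm_sq_pos (hd : 1 ≤ d) (hA : 0 < A) (hρ : 0 < ρ) :
    0 < ∫ y : EuclideanSpace ℝ (Fin d), parabolicDensity A ρ y * ‖y‖ ^ 2 := by
  have hc : Continuous fun y : EuclideanSpace ℝ (Fin d) => parabolicDensity A ρ y * ‖y‖ ^ 2 :=
    continuous_parabolicDensity.mul (by fun_prop)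
  refine hc.integral_pos_of_hasCompactSupport_nonneg_nonzero
    (x := EuclideanSpace.single (⟨0, hd⟩ : Fin d) (ρ / 2))
    (hasCompactSupport_parabolicDensity hρ.le).mul_right
    (fun y => mul_nonneg (parabolicDensity_nonneg hA.le y) (by positivity)) ?_
  have hn : ‖EuclideanSpace.single (⟨0, hd⟩ : Fin d) (ρ / 2)‖ = ρ / 2 := by
    rw [PiLp.norm_single, Real.norm_of_nonneg (by positivity)]
  have := parabolicDensity_pos hA
    (show ‖EuclideanSpace.single (⟨0, hd⟩ : Fin d) (ρ / 2)‖ < ρ by rw [hn]; linarith)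
  rw [hn]
  positivity

end Divergence

/-! ### Explicit values of the energies and of the coefficients. -/

section Energy

variable {d : ℕ} {A ρ : ℝ} {R : ℝ → ℝ} {t : ℝ} {Ω : Set (EuclideanSpace ℝ (Fin d))}

theorem setIntegral_homotheticDensity_mul (hρ : 0 ≤ ρ) (hΩ : Metric.closedBall 0 ρ ⊆ Ω)
    (ht : 0 < R t) (ht1 : R t ≤ 1) (g : EuclideanSpace ℝ (Fin d) → ℝ) :
    ∫ x in Ω, homotheticDensity R (parabolicDensity A ρ) t x * g x
      = ∫ y, parabolicDensity A ρ y * g (R t • y) := by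
  rw [setIntegral_eq_integral_of_forall_compl_eq_zero, integral_homotheticDensity_mul g ht]
  intro x hx
  rw [homotheticDensity_eq_zero hρ ht ht1, zero_mul]
  by_contra! h
  exact hx (hΩ (mem_closedBall_zero_iff.2 h.le))

theorem homotheticDensity_smul (u : EuclideanSpace ℝ (Fin d) → ℝ) (ht : 0 < R t)
    (y : EuclideanSpace ℝ (Fin d)) : homotheticDensity R u t (R t • y) = (R t ^ d)⁻¹ * u y := by
  rw [homotheticDensity, smul_smul, inv_mul_cancel₀ ht.ne', one_smul]

theorem energyF_homotheticDensity (hρ : 0 ≤ ρ) (hΩ : Metric.closedBall 0 ρ ⊆ Ω)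
    (ht : 0 < R t) (ht1 : R t ≤ 1) :
    energyF Ω 2 (homotheticDensity R (parabolicDensity A ρ)) t
      = (R t ^ d)⁻¹ * ∫ y : EuclideanSpace ℝ (Fin d), parabolicDensity A ρ y ^ 2 := by
  simp only [energyF, Real.rpow_two, sq]
  rw [setIntegral_homotheticDensity_mul hρ hΩ ht ht1, ← integral_const_mul]
  refine integral_congr_ae (ae_of_all _ fun y => ?_)
  simp only [homotheticDensity_smul _ ht]
  ring

theorem energyV_homotheticField (hρ : 0 ≤ ρ) (hΩ : Metric.closedBall 0 ρ ⊆ Ω)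
    (ht : 0 < R t) (ht1 : R t ≤ 1) :
    energyV Ω 2 (homotheticDensity R (parabolicDensity A ρ)) (homotheticField R) t
      = derivWithin R (Icc 0 1) t ^ 2 *
        ∫ y : EuclideanSpace ℝ (Fin d), parabolicDensity A ρ y * ‖y‖ ^ 2 := by
  simp only [energyV, Real.rpow_two]
  simp only [mul_comm (‖_‖ ^ 2)]
  rw [setIntegral_homotheticDensity_mul hρ hΩ ht ht1, ← integral_const_mul]
  refine integral_congr_ae (ae_of_all _ fun y => ?_)
  simp only [homotheticField_smul ht, norm_smul, mul_pow, Real.norm_eq_abs, sq_abs]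
  ring

theorem rpow_half_energyV (hρ : 0 ≤ ρ) (hΩ : Metric.closedBall 0 ρ ⊆ Ω)
    (ht : 0 < R t) (ht1 : R t ≤ 1) :
    energyV Ω 2 (homotheticDensity R (parabolicDensity A ρ)) (homotheticField R) t ^ (1 / 2 : ℝ)
      = |derivWithin R (Icc 0 1) t| *
        √(∫ y : EuclideanSpace ℝ (Fin d), parabolicDensity A ρ y * ‖y‖ ^ 2) := by
  rw [energyV_homotheticField hρ hΩ ht ht1, ← Real.sqrt_eq_rpow, Real.sqrt_mul (sq_nonneg _),
    Real.sqrt_sq_eq_abs]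

theorem coeffH_homothetic (hρ : 0 ≤ ρ) (hΩ : Metric.closedBall 0 ρ ⊆ Ω)
    (ht : 0 < R t) (ht1 : R t ≤ 1) :
    coeffH Ω 2 2 1 (1 / 2) (homotheticDensity R (parabolicDensity A ρ)) (homotheticField R) t
      = -(|derivWithin R (Icc 0 1) t| *
        √(∫ y : EuclideanSpace ℝ (Fin d), parabolicDensity A ρ y * ‖y‖ ^ 2)) := by
  -- With `α = 1` the energy `F` enters `H` with exponent zero.
  rw [coeffH, rpow_half_energyV hρ hΩ ht ht1, sub_self, Real.rpow_zero]
  ring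

theorem coeffK_homothetic (hA : 0 ≤ A) (hρ : 0 ≤ ρ) (hΩ : Metric.closedBall 0 ρ ⊆ Ω)
    (ht : 0 < R t) (ht1 : R t ≤ 1) :
    coeffK Ω 2 2 1 (1 / 2) (homotheticDensity R (parabolicDensity A ρ)) (homotheticField R) t
      = (R t ^ d)⁻¹ * (∫ y : EuclideanSpace ℝ (Fin d), parabolicDensity A ρ y ^ 2) *
        (|derivWithin R (Icc 0 1) t| *
          √(∫ y : EuclideanSpace ℝ (Fin d), parabolicDensity A ρ y * ‖y‖ ^ 2))⁻¹ := by
  have hV : 0 ≤ energyV Ω 2 (homotheticDensity R (parabolicDensity A ρ)) (homotheticField R) t := by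
    rw [energyV_homotheticField hρ hΩ ht ht1]
    exact mul_nonneg (sq_nonneg _) (integral_nonneg fun y =>
      mul_nonneg (parabolicDensity_nonneg hA y) (sq_nonneg _))
  rw [coeffK, show (1 / 2 - 1 : ℝ) = -(1 / 2) by norm_num, Real.rpow_neg hV,
    rpow_half_energyV hρ hΩ ht ht1, energyF_homotheticDensity hρ hΩ ht ht1, Real.rpow_one]
  ring

end Energy

/-! ### Localization in time and space-time integrals. -/

section SpaceTime

variable {d : ℕ} {A ρ : ℝ} {R : ℝ → ℝ} {Ω : Set (EuclideanSpace ℝ (Fin d))}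

theorem exists_Ioo_superset_of_isCompact {K : Set ℝ} (hK : IsCompact K) (hsub : K ⊆ Ioo 0 1) :
    ∃ a b : ℝ, 0 < a ∧ a < b ∧ b < 1 ∧ K ⊆ Ioo a b := by
  rcases K.eq_empty_or_nonempty with rfl | hne
  · exact ⟨1 / 3, 1 / 2, by norm_num, by norm_num, by norm_num, empty_subset _⟩
  · have h1 := hsub (hK.sInf_mem hne)
    have h2 := hsub (hK.sSup_mem hne)
    have h3 := csInf_le hK.bddBelow (hK.sSup_mem hne)
    refine ⟨sInf K / 2, (1 + sSup K) / 2, by linarith [h1.1], by linarith [h1.1, h2.2],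
      by linarith [h2.2], fun x hx => ?_⟩
    have h4 := csInf_le hK.bddBelow hx
    have h5 := le_csSup hK.bddAbove hx
    exact ⟨by linarith [h1.1], by linarith [h2.2]⟩

/-- A compactly supported function on `]0,1[ × ℝᵈ` is supported in a smaller time interval. -/
theorem exists_time_support {F : Type*} [NormedAddCommGroup F]
    {ξ : ℝ × EuclideanSpace ℝ (Fin d) → F} (hc : HasCompactSupport ξ)
    {S : Set (EuclideanSpace ℝ (Fin d))} (hsub : tsupport ξ ⊆ Ioo (0 : ℝ) 1 ×ˢ S) :
    ∃ a b : ℝ, 0 < a ∧ a < b ∧ b < 1 ∧ ∀ t ∉ Ioo a b, ∀ x, (t, x) ∉ tsupport ξ := by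
  obtain ⟨a, b, ha, hab, hb, h⟩ := exists_Ioo_superset_of_isCompact
    (IsCompact.image hc continuous_fst) (by
      rintro _ ⟨z, hz, rfl⟩
      exact (hsub hz).1)
  exact ⟨a, b, ha, hab, hb, fun t ht x hx => ht (h ⟨(t, x), hx, rfl⟩)⟩

theorem hasDerivAt_time_section {F : Type*} [NormedAddCommGroup F] [NormedSpace ℝ F]
    {ξ : ℝ × EuclideanSpace ℝ (Fin d) → F} (hξ : ContDiff ℝ ∞ ξ) (t : ℝ)
    (x : EuclideanSpace ℝ (Fin d)) :
    HasDerivAt (fun s => ξ (s, x)) (fderiv ℝ ξ (t, x) (1, 0)) t :=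
  ((hξ.differentiable (by simp) (t, x)).hasFDerivAt).comp_hasDerivAt t
    ((hasDerivAt_id t).prodMk (hasDerivAt_const t x))

theorem fderiv_space_section {F : Type*} [NormedAddCommGroup F] [NormedSpace ℝ F]
    {ξ : ℝ × EuclideanSpace ℝ (Fin d) → F} (hξ : ContDiff ℝ ∞ ξ) (t : ℝ)
    (x w : EuclideanSpace ℝ (Fin d)) :
    fderiv ℝ (fun y => ξ (t, y)) x w = fderiv ℝ ξ (t, x) (0, w) := by
  have h : HasFDerivAt (fun y => ξ (t, y)) ((fderiv ℝ ξ (t, x)).comp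
      (ContinuousLinearMap.inr ℝ ℝ (EuclideanSpace ℝ (Fin d)))) x :=
    ((hξ.differentiable (by simp) (t, x)).hasFDerivAt).comp x (hasFDerivAt_prodMk_right t x)
  rw [h.fderiv]
  rfl

/-- The derivative along the trajectory of `y` is the material derivative: the direction is `(1, v)`
evaluated at `R(t) y`. -/
theorem hasDerivAt_along_homothety {F : Type*} [NormedAddCommGroup F] [NormedSpace ℝ F]
    {ξ : ℝ × EuclideanSpace ℝ (Fin d) → F} (hξ : ContDiff ℝ ∞ ξ)
    (hR : ContDiffOn ℝ 1 R (Icc 0 1)) {t : ℝ} (ht : t ∈ Ioo (0 : ℝ) 1)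
    (y : EuclideanSpace ℝ (Fin d)) :
    HasDerivAt (fun s => ξ (s, R s • y))
      (fderiv ℝ ξ (t, R t • y) (1, derivWithin R (Icc 0 1) t • y)) t :=
  ((hξ.differentiable (by simp) (t, R t • y)).hasFDerivAt).comp_hasDerivAt t
    ((hasDerivAt_id t).prodMk ((hasDerivAt_of_mem_Ioo hR ht).smul_const y))

theorem continuousOn_homotheticDensity {u : EuclideanSpace ℝ (Fin d) → ℝ} (hu : Continuous u)
    {I : Set ℝ} (hR : ContinuousOn R I) (hpos : ∀ t ∈ I, 0 < R t) :
    ContinuousOn (fun z : ℝ × EuclideanSpace ℝ (Fin d) => homotheticDensity R u z.1 z.2)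
      (I ×ˢ univ) := by
  have hRz : ContinuousOn (fun z : ℝ × EuclideanSpace ℝ (Fin d) => R z.1) (I ×ˢ univ) :=
    hR.comp continuousOn_fst fun z hz => hz.1
  unfold homotheticDensity
  exact ((hRz.pow d).inv₀ fun z hz => pow_ne_zero _ (hpos _ hz.1).ne').mul
    (hu.comp_continuousOn ((hRz.inv₀ fun z hz => (hpos _ hz.1).ne').smul continuousOn_snd))

theorem ae_prod_of_ae_fst {p : ℝ → Prop} (h : ∀ᵐ t, p t) :
    ∀ᵐ z : ℝ × EuclideanSpace ℝ (Fin d), p z.1 :=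
  Measure.quasiMeasurePreserving_fst.ae h

/-- Space-time integrals against the homothetic density, in Lagrangian coordinates. -/
theorem setIntegral_homothetic_eq (hA : 0 ≤ A) (hρ : 0 ≤ ρ) (hΩm : MeasurableSet Ω)
    (hΩ : Metric.closedBall 0 ρ ⊆ Ω) {a b : ℝ} (ha : 0 < a) (hab : a < b) (hb : b < 1)
    (hR : ContinuousOn R (Icc a b)) (hpos : ∀ t ∈ Icc a b, 0 < R t)
    (hle : ∀ t ∈ Icc a b, R t ≤ 1)
    {I : ℝ × EuclideanSpace ℝ (Fin d) → ℝ} {J : ℝ → EuclideanSpace ℝ (Fin d) → ℝ}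
    (hJ : ContinuousOn (fun z : ℝ × EuclideanSpace ℝ (Fin d) => J z.1 z.2) (Icc a b ×ˢ univ))
    (hI0 : ∀ t ∉ Ioo a b, ∀ x, I (t, x) = 0)
    (hIJ : ∀ᵐ t, t ∈ Ioo a b → ∀ x, I (t, x) =
      homotheticDensity R (parabolicDensity A ρ) t x * J t x) :
    ∫ z in Ioo (0 : ℝ) 1 ×ˢ Ω, I z = ∫ t in a..b, ∫ y, J t (R t • y)
      ∂(volume.withDensity fun x => ENNReal.ofReal (parabolicDensity A ρ x)) := by
  set G : ℝ × EuclideanSpace ℝ (Fin d) → ℝ := fun z =>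
    homotheticDensity R (parabolicDensity A ρ) z.1 z.2 * J z.1 z.2 with hG
  have hGc : ContinuousOn G (Icc a b ×ˢ univ) :=
    (continuousOn_homotheticDensity continuous_parabolicDensity hR hpos).mul hJ
  have hG0 : ∀ z : ℝ × EuclideanSpace ℝ (Fin d), z.1 ∈ Ioo a b → ρ ≤ ‖z.2‖ → G z = 0 := by
    intro z hz hzρ
    have hz' := Ioo_subset_Icc_self hz
    rw [hG]
    simp only
    rw [homotheticDensity_eq_zero hρ (hpos _ hz') (hle _ hz') hzρ, zero_mul]
  have hGint : IntegrableOn G (Ioo a b ×ˢ univ) := by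
    have h1 : IntegrableOn G (Icc a b ×ˢ Metric.closedBall 0 ρ) :=
      (hGc.mono (prod_mono_right (subset_univ _))).integrableOn_compact
        (isCompact_Icc.prod (isCompact_closedBall _ _))
    have h2 := h1.mono_set (prod_mono_left (Ioo_subset_Icc_self (a := a) (b := b)))
    refine h2.of_forall_sdiff_eq_zero (measurableSet_Ioo.prod MeasurableSet.univ) ?_
    rintro z ⟨hz1, hz2⟩
    refine hG0 z hz1.1 ?_
    by_contra! h
    exact hz2 ⟨hz1.1, mem_closedBall_zero_iff.2 h.le⟩
  -- The test function cuts the time interval down to `]a,b[`, the coefficients are replaced off a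
  -- null set of times, and `Ω` is enlarged to the whole space because the density vanishes outside
  -- the ball. Fubini and the change of variables finish.
  have step1 : ∫ z in Ioo (0 : ℝ) 1 ×ˢ Ω, I z = ∫ z in Ioo a b ×ˢ Ω, I z := by
    refine setIntegral_eq_of_subset_of_forall_sdiff_eq_zero (measurableSet_Ioo.prod hΩm)
      (prod_mono_left (Ioo_subset_Ioo ha.le hb.le)) ?_
    rintro z ⟨hz1, hz2⟩
    exact hI0 z.1 (fun h => hz2 ⟨h, hz1.2⟩) z.2
  have step2 : ∫ z in Ioo a b ×ˢ Ω, I z = ∫ z in Ioo a b ×ˢ Ω, G z := by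
    refine setIntegral_congr_ae (measurableSet_Ioo.prod hΩm) ?_
    filter_upwards [ae_prod_of_ae_fst hIJ] with z hz hzm
    exact hz hzm.1 z.2
  have step3 : ∫ z in Ioo a b ×ˢ Ω, G z = ∫ z in Ioo a b ×ˢ univ, G z := by
    refine (setIntegral_eq_of_subset_of_forall_sdiff_eq_zero
      (measurableSet_Ioo.prod MeasurableSet.univ) (prod_mono_right (subset_univ _)) ?_).symm
    rintro z ⟨hz1, hz2⟩
    refine hG0 z hz1.1 ?_
    by_contra! h
    exact hz2 ⟨hz1.1, hΩ (mem_closedBall_zero_iff.2 h.le)⟩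
  rw [step1, step2, step3, Measure.volume_eq_prod, setIntegral_prod _ hGint,
    intervalIntegral.integral_of_le hab.le, ← integral_Ioc_eq_integral_Ioo]
  refine setIntegral_congr_fun measurableSet_Ioc fun t ht => ?_
  simp only [hG]
  rw [Measure.restrict_univ, integral_homotheticDensity_mul _ (hpos t (Ioc_subset_Icc_self ht)),
    integral_withDensity_ofReal continuous_parabolicDensity.measurable
      (parabolicDensity_nonneg hA)]

/-- Intended for the terms containing `K`: they agree with continuous expressions except at times
where `R' = 0`, which form a null set. -/
theorem locallyIntegrableOn_of_ae_eq_continuousOn {F : Type*} [NormedAddCommGroup F]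
    {f g : ℝ × EuclideanSpace ℝ (Fin d) → F} {I : Set ℝ} (hI : IsOpen I)
    {S : Set (EuclideanSpace ℝ (Fin d))} (hS : MeasurableSet S)
    (hg : ContinuousOn g (I ×ˢ univ)) (h : ∀ᵐ t, t ∈ I → ∀ x, f (t, x) = g (t, x)) :
    LocallyIntegrableOn f (I ×ˢ S) := by
  intro z hz
  have hmeas : MeasurableSet (I ×ˢ S) := hI.measurableSet.prod hS
  obtain ⟨U, hU, hgU⟩ := (hg.mono (prod_mono_right (subset_univ S))).locallyIntegrableOn
    (μ := volume) hmeas z hz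
  refine ⟨U ∩ I ×ˢ S, inter_mem hU self_mem_nhdsWithin, ?_⟩
  refine (hgU.mono_set inter_subset_left).congr ?_
  have h1 : ∀ᵐ z ∂(volume.restrict (I ×ˢ S)), g z = f z := by
    refine (ae_restrict_iff' hmeas).2 ?_
    filter_upwards [ae_prod_of_ae_fst h] with z hz hzm
    exact (hz hzm.1 z.2).symm
  exact ae_mono (Measure.restrict_mono inter_subset_right le_rfl) h1

end SpaceTime

/-! ### The two equations in weak form. -/

section Equations

variable {d : ℕ} {A ρ : ℝ} {R : ℝ → ℝ} {Ω : Set (EuclideanSpace ℝ (Fin d))}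

theorem continuousOn_scaling_smul (hR : ContDiffOn ℝ 1 R (Icc 0 1)) {I : Set ℝ}
    (hI : I ⊆ Icc 0 1) :
    ContinuousOn (fun z : ℝ × EuclideanSpace ℝ (Fin d) => R z.1 • z.2) (I ×ˢ univ) :=
  (hR.continuousOn.comp continuousOn_fst fun _ hz => hI hz.1).smul continuousOn_snd

theorem continuousOn_derivWithin_smul (hR : ContDiffOn ℝ 1 R (Icc 0 1)) {I : Set ℝ}
    (hI : I ⊆ Icc 0 1) :
    ContinuousOn (fun z : ℝ × EuclideanSpace ℝ (Fin d) => derivWithin R (Icc 0 1) z.1 • z.2)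
      (I ×ˢ univ) :=
  ((continuousOn_derivWithin_Icc hR).comp continuousOn_fst fun _ hz => hI hz.1).smul
    continuousOn_snd

theorem continuousOn_homotheticField (hR : ContDiffOn ℝ 1 R (Icc 0 1)) {I : Set ℝ}
    (hI : I ⊆ Icc 0 1) (hpos : ∀ t ∈ I, 0 < R t) :
    ContinuousOn (fun z : ℝ × EuclideanSpace ℝ (Fin d) => homotheticField R z.1 z.2)
      (I ×ˢ univ) := by
  unfold homotheticField
  exact (((continuousOn_derivWithin_Icc hR).comp continuousOn_fst fun _ hz => hI hz.1).div
    (hR.continuousOn.comp continuousOn_fst fun _ hz => hI hz.1)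
    fun z hz => (hpos _ hz.1).ne').smul continuousOn_snd

theorem weak_continuity_homothetic (hA : 0 ≤ A) (hρ : 0 ≤ ρ)
    (hprob : IsProbabilityMeasure (volume.withDensity fun x : EuclideanSpace ℝ (Fin d) =>
      ENNReal.ofReal (parabolicDensity A ρ x)))
    (hΩm : MeasurableSet Ω) (hΩ : Metric.closedBall 0 ρ ⊆ Ω)
    (hR : ContDiffOn ℝ 1 R (Icc 0 1)) (hRmaps : MapsTo R (Icc 0 1) (Icc 0 1))
    (hpos : ∀ t ∈ Ioo (0 : ℝ) 1, 0 < R t)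
    {φ : ℝ × EuclideanSpace ℝ (Fin d) → ℝ} (hφ : ContDiff ℝ ∞ φ) (hφc : HasCompactSupport φ)
    (hφs : tsupport φ ⊆ Ioo (0 : ℝ) 1 ×ˢ univ) :
    ∫ z in Ioo (0 : ℝ) 1 ×ˢ Ω, homotheticDensity R (parabolicDensity A ρ) z.1 z.2 *
      (deriv (fun s => φ (s, z.2)) z.1
        + fderiv ℝ (fun y => φ (z.1, y)) z.2 (homotheticField R z.1 z.2)) = 0 := by
  obtain ⟨a, b, ha, hab, hb, hsupp⟩ := exists_time_support hφc hφs
  have hsub : Icc a b ⊆ Ioo 0 1 := fun t ht => ⟨ha.trans_le ht.1, ht.2.trans_lt hb⟩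
  have hsub' : Icc a b ⊆ Icc 0 1 := hsub.trans Ioo_subset_Icc_self
  have hposI : ∀ t ∈ Icc a b, 0 < R t := fun t ht => hpos t (hsub ht)
  have hsum : ∀ t x w, deriv (fun s => φ (s, x)) t + fderiv ℝ (fun y => φ (t, y)) x w
      = fderiv ℝ φ (t, x) (1, w) := fun t x w => by
    rw [(hasDerivAt_time_section hφ t x).deriv, fderiv_space_section hφ, ← map_add]
    simp
  have hcφ : Continuous (fderiv ℝ φ) := hφ.continuous_fderiv (by simp)
  have hν := withDensity_parabolicDensity_compl_closedBall (d := d) (A := A) hρ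
  simp only [hsum]
  rw [setIntegral_homothetic_eq hA hρ hΩm hΩ ha hab hb (hR.continuousOn.mono hsub') hposI
    (fun t ht => (hRmaps (hsub' ht)).2)
    (J := fun t x => fderiv ℝ φ (t, x) (1, homotheticField R t x))]
  -- The integrand is the total time derivative of `φ(s, R(s) y)`, which vanishes at both ends `a`
  -- and `b`.
  · obtain ⟨-, heq⟩ := intervalIntegral_integral_eq_sub
      (g := fun s y => φ (s, R s • y))
      (g' := fun s y => fderiv ℝ φ (s, R s • y) (1, derivWithin R (Icc 0 1) s • y)) hν hab.le
      (hφ.continuous.comp_continuousOn (continuousOn_fst.prodMk (continuousOn_scaling_smul hR hsub')))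
      ((hcφ.comp_continuousOn
        (continuousOn_fst.prodMk (continuousOn_scaling_smul hR hsub'))).clm_apply
        (continuousOn_const.prodMk (continuousOn_derivWithin_smul hR hsub')))
      (fun s hs y => hasDerivAt_along_homothety hφ hR (hsub (Ioo_subset_Icc_self hs)) y)
    have hend : ∀ t ∉ Ioo a b, ∀ x, φ (t, x) = 0 := fun t ht x =>
      image_eq_zero_of_notMem_tsupport (hsupp t ht x)
    simp only [hend b (by simp), hend a (by simp), integral_zero, sub_zero] at heq
    refine Eq.trans ?_ heq
    refine intervalIntegral.integral_congr fun t ht => ?_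
    rw [uIcc_of_le hab.le] at ht
    simp only [homotheticField_smul (hposI t ht)]
  · exact hcφ.continuousOn.clm_apply (continuousOn_const.prodMk
      (continuousOn_homotheticField hR hsub' hposI))
  · intro t ht x
    simp only
    rw [fderiv_of_notMem_tsupport ℝ (hsupp t ht x)]
    simp
  · exact ae_of_all _ fun t _ x => rfl

/-- Writing `(f t)⁻¹ * (f t ^ n)⁻¹` avoids the exponent `n - 1` and covers `n = 0`. -/
theorem hasDerivAt_inv_pow {f : ℝ → ℝ} {f' t : ℝ} (hf : HasDerivAt f f' t) (ht : f t ≠ 0) (n : ℕ) :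
    HasDerivAt (fun s => (f s ^ n)⁻¹) (-(n * f' * (f t)⁻¹ * (f t ^ n)⁻¹)) t := by
  have h := (hf.pow n).inv (pow_ne_zero n ht)
  refine h.congr_deriv ?_
  cases n with
  | zero => simp
  | succ n =>
    simp only [Pi.pow_apply, Nat.add_sub_cancel]
    field_simp
    ring

theorem spaceDiv_eq {ξ : ℝ × EuclideanSpace ℝ (Fin d) → EuclideanSpace ℝ (Fin d)}
    (hξ : ContDiff ℝ ∞ ξ) (t : ℝ) (x : EuclideanSpace ℝ (Fin d)) :
    spaceDiv ξ t x = ∑ i, (fderiv ℝ ξ (t, x) (0, EuclideanSpace.single i 1)) i := by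
  simp only [spaceDiv, fderiv_space_section hξ]

theorem continuous_spaceDiv {ξ : ℝ × EuclideanSpace ℝ (Fin d) → EuclideanSpace ℝ (Fin d)}
    (hξ : ContDiff ℝ ∞ ξ) :
    Continuous fun z : ℝ × EuclideanSpace ℝ (Fin d) => spaceDiv ξ z.1 z.2 := by
  simp only [spaceDiv_eq hξ]
  exact continuous_finsetSum _ fun i _ => (EuclideanSpace.proj (𝕜 := ℝ) i).continuous.comp
    ((hξ.continuous_fderiv (by simp)).clm_apply continuous_const)

/-- The pressure term in Lagrangian coordinates. -/
theorem integral_parabolicDensity_sq_mul_spaceDiv (hρ : 0 ≤ ρ)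
    {ξ : ℝ × EuclideanSpace ℝ (Fin d) → EuclideanSpace ℝ (Fin d)} (hξ : ContDiff ℝ ∞ ξ)
    {t r : ℝ} :
    r * ∫ y, parabolicDensity A ρ y ^ 2 * spaceDiv ξ t (r • y)
      = 4 * A * ∫ y, parabolicDensity A ρ y * inner ℝ y (ξ (t, r • y)) := by
  have hη : ContDiff ℝ 1 fun y : EuclideanSpace ℝ (Fin d) => ξ (t, r • y) :=
    (hξ.of_le (by exact_mod_cast le_top)).comp (contDiff_const.prodMk (contDiff_const_smul r))
  have hfd : ∀ y w, fderiv ℝ (fun y => ξ (t, r • y)) y w = r • fderiv ℝ ξ (t, r • y) (0, w) := by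
    intro y w
    have h : HasFDerivAt (fun y => ξ (t, r • y)) ((fderiv ℝ ξ (t, r • y)).comp
        ((ContinuousLinearMap.inr ℝ ℝ (EuclideanSpace ℝ (Fin d))).comp
          (r • ContinuousLinearMap.id ℝ (EuclideanSpace ℝ (Fin d))))) y :=
      ((hξ.differentiable (by simp) (t, r • y)).hasFDerivAt).comp y
        ((hasFDerivAt_prodMk_right t (r • y)).comp y ((hasFDerivAt_id y).const_smul r))
    rw [h.fderiv]
    simp [-Prod.smul_mk]
  rw [← integral_parabolicDensity_sq_mul_div hρ hη, ← integral_const_mul]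
  refine integral_congr_ae (ae_of_all _ fun y => ?_)
  simp only [hfd, spaceDiv_eq hξ, PiLp.smul_apply, smul_eq_mul, ← Finset.mul_sum]
  ring

theorem weak_momentum_homothetic (hd : 1 ≤ d) (hA : 0 < A) (hρ : 0 < ρ)
    (hprob : IsProbabilityMeasure (volume.withDensity fun x : EuclideanSpace ℝ (Fin d) =>
      ENNReal.ofReal (parabolicDensity A ρ x)))
    (hΩm : MeasurableSet Ω) (hΩ : Metric.closedBall 0 ρ ⊆ Ω)
    (hR : ContDiffOn ℝ 1 R (Icc 0 1)) (hRmaps : MapsTo R (Icc 0 1) (Icc 0 1))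
    (hpos : ∀ t ∈ Ioo (0 : ℝ) 1, 0 < R t) {σ : ℝ} (hσ : σ * σ = 1)
    (habs : ∀ t, |derivWithin R (Icc 0 1) t| = σ * derivWithin R (Icc 0 1) t)
    (hderiv : ∀ᵐ t, t ∈ Ioo (0 : ℝ) 1 → derivWithin R (Icc 0 1) t ≠ 0)
    {ξ : ℝ × EuclideanSpace ℝ (Fin d) → EuclideanSpace ℝ (Fin d)} (hξ : ContDiff ℝ ∞ ξ)
    (hξc : HasCompactSupport ξ) (hξs : tsupport ξ ⊆ Ioo (0 : ℝ) 1 ×ˢ interior Ω) :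
    ∫ z in Ioo (0 : ℝ) 1 ×ˢ Ω,
      (coeffH Ω 2 2 1 (1 / 2) (homotheticDensity R (parabolicDensity A ρ)) (homotheticField R) z.1
          * homotheticDensity R (parabolicDensity A ρ) z.1 z.2 ^ (2 : ℝ) * spaceDiv ξ z.1 z.2
        + coeffK Ω 2 2 1 (1 / 2) (homotheticDensity R (parabolicDensity A ρ)) (homotheticField R)
            z.1 * homotheticDensity R (parabolicDensity A ρ) z.1 z.2 *
            ‖homotheticField R z.1 z.2‖ ^ (2 - 2 : ℝ) *
          (inner ℝ (homotheticField R z.1 z.2)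
            (fderiv ℝ (fun y => ξ (z.1, y)) z.2 (homotheticField R z.1 z.2))
            + inner ℝ (homotheticField R z.1 z.2) (deriv (fun s => ξ (s, z.2)) z.1))) = 0 := by
  obtain ⟨a, b, ha, hab, hb, hsupp⟩ := exists_time_support hξc hξs
  have hsub : Icc a b ⊆ Ioo 0 1 := fun t ht => ⟨ha.trans_le ht.1, ht.2.trans_lt hb⟩
  have hsub' : Icc a b ⊆ Icc 0 1 := hsub.trans Ioo_subset_Icc_self
  have hposI : ∀ t ∈ Icc a b, 0 < R t := fun t ht => hpos t (hsub ht)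
  have hleI : ∀ t ∈ Icc a b, R t ≤ 1 := fun t ht => (hRmaps (hsub' ht)).2
  have hν := withDensity_parabolicDensity_compl_closedBall (d := d) (A := A) hρ.le
  set ν := volume.withDensity fun x : EuclideanSpace ℝ (Fin d) =>
    ENNReal.ofReal (parabolicDensity A ρ x) with hν_def
  have hcξ : Continuous (fderiv ℝ ξ) := hξ.continuous_fderiv (by simp)
  have hsum : ∀ t x w, inner ℝ w (fderiv ℝ (fun y => ξ (t, y)) x w)
      + inner ℝ w (deriv (fun s => ξ (s, x)) t) = inner ℝ w (fderiv ℝ ξ (t, x) (1, w)) := by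
    intro t x w
    rw [(hasDerivAt_time_section hξ t x).deriv, fderiv_space_section hξ, ← inner_add_right,
      ← map_add]
    simp
  have hM := integral_parabolicDensity_mul_norm_sq_pos (d := d) hd hA hρ
  have hFM := dim_mul_integral_parabolicDensity_sq (d := d) (A := A) hρ.le
  set s := √(∫ y : EuclideanSpace ℝ (Fin d), parabolicDensity A ρ y * ‖y‖ ^ 2) with hs
  set F := ∫ y : EuclideanSpace ℝ (Fin d), parabolicDensity A ρ y ^ 2 with hF
  have hs0 : 0 < s := Real.sqrt_pos.2 hM
  have hss : s * s = ∫ y : EuclideanSpace ℝ (Fin d), parabolicDensity A ρ y * ‖y‖ ^ 2 :=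
    Real.mul_self_sqrt hM.le
  have hend : ∀ t ∉ Ioo a b, ∀ x, ξ (t, x) = 0 := fun t ht x =>
    image_eq_zero_of_notMem_tsupport (hsupp t ht x)
  have hcR : ContinuousOn (fun z : ℝ × EuclideanSpace ℝ (Fin d) => R z.1) (Icc a b ×ˢ univ) :=
    hR.continuousOn.comp continuousOn_fst fun z hz => hsub' hz.1
  have hcRinv : ContinuousOn (fun z : ℝ × EuclideanSpace ℝ (Fin d) => (R z.1)⁻¹)
      (Icc a b ×ˢ univ) := hcR.inv₀ fun z hz => (hposI _ hz.1).ne'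
  have hcRd : ContinuousOn (fun z : ℝ × EuclideanSpace ℝ (Fin d) => (R z.1 ^ d)⁻¹)
      (Icc a b ×ˢ univ) := (hcR.pow d).inv₀ fun z hz => pow_ne_zero _ (hposI _ hz.1).ne'
  have hcr : ContinuousOn (fun z : ℝ × EuclideanSpace ℝ (Fin d) => derivWithin R (Icc 0 1) z.1)
      (Icc a b ×ˢ univ) :=
    (continuousOn_derivWithin_Icc hR).comp continuousOn_fst fun z hz => hsub' hz.1
  have hcLag : ContinuousOn (fun z : ℝ × EuclideanSpace ℝ (Fin d) => (z.1, R z.1 • z.2))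
      (Icc a b ×ˢ univ) := continuousOn_fst.prodMk (continuousOn_scaling_smul hR hsub')
  have hcD : ContinuousOn (fun z : ℝ × EuclideanSpace ℝ (Fin d) =>
      fderiv ℝ ξ (z.1, R z.1 • z.2) (1, derivWithin R (Icc 0 1) z.1 • z.2)) (Icc a b ×ˢ univ) :=
    (hcξ.comp_continuousOn hcLag).clm_apply
      (continuousOn_const.prodMk (continuousOn_derivWithin_smul hR hsub'))
  simp only [hsum]
  -- `J` is the integrand with one factor `u` removed. In the term with `K`, the `R'` of `v` cancels
  -- against the `|R'|` in the denominator up to `σ`, so `J` is continuous even where `R'` vanishes.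
  rw [setIntegral_homothetic_eq hA.le hρ.le hΩm hΩ ha hab hb (hR.continuousOn.mono hsub') hposI hleI
    (J := fun t x => σ * (-(derivWithin R (Icc 0 1) t * s) *
      (homotheticDensity R (parabolicDensity A ρ) t x * spaceDiv ξ t x) +
      F / s * ((R t ^ d)⁻¹ * inner ℝ ((R t)⁻¹ • x)
        (fderiv ℝ ξ (t, x) (1, homotheticField R t x)))))]
  -- The primitive is the Lagrangian momentum tested with `ξ`, up to the constant `σ F / s`. The
  -- first term of its derivative comes from `R^(-d)` and has to be matched with the pressure.
  · obtain ⟨-, heq⟩ := intervalIntegral_integral_eq_sub (ν := ν)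
      (g := fun t y => (R t ^ d)⁻¹ * inner ℝ y (ξ (t, R t • y)))
      (g' := fun t y => -(d * derivWithin R (Icc 0 1) t * (R t)⁻¹ * (R t ^ d)⁻¹) *
          inner ℝ y (ξ (t, R t • y)) + (R t ^ d)⁻¹ * inner ℝ y
            (fderiv ℝ ξ (t, R t • y) (1, derivWithin R (Icc 0 1) t • y))) hν hab.le
      (hcRd.mul (continuousOn_snd.inner (hξ.continuous.comp_continuousOn hcLag)))
      (((((continuousOn_const.mul hcr).mul hcRinv).mul hcRd).neg.mul
        (continuousOn_snd.inner (hξ.continuous.comp_continuousOn hcLag))).add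
        (hcRd.mul (continuousOn_snd.inner hcD)))
      (fun t ht y => by
        have htI := Ioo_subset_Icc_self ht
        have h1 := hasDerivAt_inv_pow (hasDerivAt_of_mem_Ioo hR (hsub htI)) (hposI t htI).ne' d
        have h2 := (hasDerivAt_const t y).inner ℝ (hasDerivAt_along_homothety hξ hR (hsub htI) y)
        refine (h1.mul h2).congr_deriv ?_
        simp)
    simp only [hend b (by simp), hend a (by simp), inner_zero_right, mul_zero, integral_zero,
      sub_zero] at heq
    refine Eq.trans ?_ ((congrArg (fun c => σ * (F / s) * c) heq).trans (mul_zero _))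
    rw [← intervalIntegral.integral_const_mul]
    refine intervalIntegral.integral_congr fun t ht => ?_
    rw [uIcc_of_le hab.le] at ht
    have hRt := hposI t ht
    simp only [homotheticField_smul hRt, homotheticDensity_smul _ hRt, smul_smul,
      inv_mul_cancel₀ hRt.ne', one_smul]
    have hct : Continuous fun y : EuclideanSpace ℝ (Fin d) => (t, R t • y) := by fun_prop
    have hi1 : Integrable (fun y => parabolicDensity A ρ y * spaceDiv ξ t (R t • y)) ν :=
      integrable_of_continuous_of_compl_closedBall hν
        (continuous_parabolicDensity.mul ((continuous_spaceDiv hξ).comp hct))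
    have hi2 : Integrable (fun y => inner ℝ y (ξ (t, R t • y))) ν :=
      integrable_of_continuous_of_compl_closedBall hν
        (continuous_id.inner (hξ.continuous.comp hct))
    have hi3 : Integrable (fun y => inner ℝ y
        (fderiv ℝ ξ (t, R t • y) (1, derivWithin R (Icc 0 1) t • y))) ν :=
      integrable_of_continuous_of_compl_closedBall hν
        (continuous_id.inner ((hcξ.comp hct).clm_apply (by fun_prop)))
    have hP : R t * ∫ y, parabolicDensity A ρ y * spaceDiv ξ t (R t • y) ∂ν
        = 4 * A * ∫ y, inner ℝ y (ξ (t, R t • y)) ∂ν := by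
      rw [hν_def, integral_withDensity_ofReal continuous_parabolicDensity.measurable
        (parabolicDensity_nonneg hA.le), integral_withDensity_ofReal
        continuous_parabolicDensity.measurable (parabolicDensity_nonneg hA.le),
        ← integral_parabolicDensity_sq_mul_spaceDiv hρ.le hξ]
      simp only [← mul_assoc, sq]
    have hL : ∫ y, σ * (-(derivWithin R (Icc 0 1) t * s) *
        ((R t ^ d)⁻¹ * parabolicDensity A ρ y * spaceDiv ξ t (R t • y)) +
        F / s * ((R t ^ d)⁻¹ * inner ℝ y
          (fderiv ℝ ξ (t, R t • y) (1, derivWithin R (Icc 0 1) t • y)))) ∂ν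
        = σ * (-(derivWithin R (Icc 0 1) t * s) * ((R t ^ d)⁻¹ *
          ∫ y, parabolicDensity A ρ y * spaceDiv ξ t (R t • y) ∂ν) +
        F / s * ((R t ^ d)⁻¹ * ∫ y, inner ℝ y
          (fderiv ℝ ξ (t, R t • y) (1, derivWithin R (Icc 0 1) t • y)) ∂ν)) := by
      simp only [mul_assoc (R t ^ d)⁻¹]
      rw [integral_const_mul, integral_add ((hi1.const_mul _).const_mul _)
        ((hi3.const_mul _).const_mul _), integral_const_mul, integral_const_mul,
        integral_const_mul, integral_const_mul]
    refine hL.trans ?_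
    rw [integral_add (hi2.const_mul _) (hi3.const_mul _), integral_const_mul,
      integral_const_mul]
    have hPe : ∫ y, parabolicDensity A ρ y * spaceDiv ξ t (R t • y) ∂ν
        = (R t)⁻¹ * (4 * A * ∫ y, inner ℝ y (ξ (t, R t • y)) ∂ν) := by
      rw [← hP, inv_mul_cancel_left₀ hRt.ne']
    -- The relation `d F = 4A s²` divided by `s`: pressure and momentum constants coincide.
    have hFs : s * (4 * A) = F / s * d := by
      field_simp
      rw [← hss] at hFM
      linarith
    rw [hPe]
    linear_combination (-(σ * derivWithin R (Icc 0 1) t * (R t ^ d)⁻¹ * (R t)⁻¹ *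
      ∫ y, inner ℝ y (ξ (t, R t • y)) ∂ν)) * hFs
  · refine continuousOn_const.mul (((hcr.mul continuousOn_const).neg.mul
      ((continuousOn_homotheticDensity continuous_parabolicDensity
        (hR.continuousOn.mono hsub') hposI).mul (continuous_spaceDiv hξ).continuousOn)).add
      (continuousOn_const.mul (hcRd.mul ((hcRinv.smul continuousOn_snd).inner
        (hcξ.continuousOn.clm_apply (continuousOn_const.prodMk
          (continuousOn_homotheticField hR hsub' hposI)))))))
  · intro t ht x
    have h0 : fderiv ℝ ξ (t, x) = 0 := fderiv_of_notMem_tsupport ℝ (hsupp t ht x)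
    simp [spaceDiv_eq hξ, h0]
  -- At times with `R' ≠ 0` the cancellation of `R'` is legitimate, and `σ⁻¹ = σ` puts the sign of
  -- `K` in front.
  · filter_upwards [hderiv] with t ht htab x
    have htI := Ioo_subset_Icc_self htab
    have hr := ht (hsub htI)
    have hv : homotheticField R t x = derivWithin R (Icc 0 1) t • ((R t)⁻¹ • x) := by
      rw [homotheticField, smul_smul, div_eq_mul_inv]
    rw [coeffH_homothetic hρ.le hΩ (hposI t htI) (hleI t htI),
      coeffK_homothetic hA.le hρ.le hΩ (hposI t htI) (hleI t htI), habs, ← hs, ← hF, sub_self,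
      Real.rpow_zero, Real.rpow_two]
    have hin : ∀ w, inner ℝ (homotheticField R t x) w =
        derivWithin R (Icc 0 1) t * inner ℝ ((R t)⁻¹ • x) w := fun w => by
      rw [hv, real_inner_smul_left]
    have hσi : σ⁻¹ = σ := inv_eq_of_mul_eq_one_left hσ
    simp only [hin]
    rw [mul_inv, mul_inv, hσi]
    field_simp

end Equations

/-! ### Assembly of the weak solution and the boundary condition. -/

section WeakSolution

variable {d : ℕ} {A ρ : ℝ} {R : ℝ → ℝ} {Ω : Set (EuclideanSpace ℝ (Fin d))}

theorem noFlux_homothetic (hρ : 0 < ρ) (hΩ : Metric.closedBall 0 ρ ⊆ Ω)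
    (hRmaps : MapsTo R (Icc 0 1) (Icc 0 1)) (hpos : ∀ t ∈ Ioo (0 : ℝ) 1, 0 < R t) :
    NoFlux Ω (homotheticDensity R (parabolicDensity A ρ)) (homotheticField R) := by
  intro t ht x hx n _
  -- A boundary point of `Ω` cannot lie in the open ball, which is interior to `Ω`; so the density
  -- itself vanishes there, whatever the normal.
  have hle : ρ ≤ ‖x‖ := by
    by_contra! h
    exact hx.2 (interior_mono hΩ (Metric.ball_subset_interior_closedBall
      (mem_ball_zero_iff.2 h)))
  rw [homotheticDensity_eq_zero hρ.le (hpos t ht) (hRmaps (Ioo_subset_Icc_self ht)).2 hle,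
    zero_smul, inner_zero_left]

theorem integrableOn_of_continuous_mul_homotheticDensity {t : ℝ} (hρ : 0 ≤ ρ) (ht : 0 < R t)
    (ht1 : R t ≤ 1) {g : EuclideanSpace ℝ (Fin d) → ℝ} (hg : Continuous g) :
    IntegrableOn (fun x => g x * homotheticDensity R (parabolicDensity A ρ) t x) Ω := by
  have hc : HasCompactSupport
      (homotheticDensity R (parabolicDensity A ρ) t : EuclideanSpace ℝ (Fin d) → ℝ) := by
    refine HasCompactSupport.intro (isCompact_closedBall 0 ρ) fun x hx => ?_
    rw [mem_closedBall_zero_iff, not_le] at hx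
    exact homotheticDensity_eq_zero hρ ht ht1 hx.le
  exact ((hg.mul (continuous_homotheticDensity
    continuous_parabolicDensity)).integrable_of_hasCompactSupport hc.mul_left).integrableOn

/-- Narrow continuity of the homothetic curve. -/
theorem tendsto_integral_homotheticDensity (hA : 0 ≤ A) (hρ : 0 ≤ ρ)
    (hprob : IsProbabilityMeasure (volume.withDensity fun x : EuclideanSpace ℝ (Fin d) =>
      ENNReal.ofReal (parabolicDensity A ρ x)))
    (hΩ : Metric.closedBall 0 ρ ⊆ Ω) (hR : ContDiffOn ℝ 1 R (Icc 0 1))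
    (hRmaps : MapsTo R (Icc 0 1) (Icc 0 1)) (hpos : ∀ t ∈ Ioo (0 : ℝ) 1, 0 < R t)
    {f : EuclideanSpace ℝ (Fin d) → ℝ} (hf : Continuous f) {t₀ : ℝ} (ht₀ : t₀ ∈ Icc (0 : ℝ) 1) :
    Tendsto (fun t => ∫ x in Ω, f x * homotheticDensity R (parabolicDensity A ρ) t x)
      (𝓝[Ioo 0 1] t₀) (𝓝 (∫ x, f x ∂(homotheticCurve R
        (volume.withDensity fun x => ENNReal.ofReal (parabolicDensity A ρ x)) t₀))) := by
  have hν := withDensity_parabolicDensity_compl_closedBall (d := d) (A := A) hρ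
  rw [integral_homotheticCurve _ hf.aestronglyMeasurable]
  -- The Lagrangian integral of `f(R(t) y)` is continuous on all of `[0,1]`, including an endpoint
  -- where `R` vanishes and the limit is a Dirac mass.
  have h := (continuousOn_integral_of_compl_closedBall (g := fun t y => f (R t • y)) hν
    (hf.comp_continuousOn (continuousOn_scaling_smul hR subset_rfl)) t₀ ht₀).tendsto.mono_left
    (nhdsWithin_mono t₀ Ioo_subset_Icc_self)
  refine h.congr' ?_
  filter_upwards [self_mem_nhdsWithin] with t ht
  simp only [mul_comm (f _)]
  rw [setIntegral_homotheticDensity_mul hρ hΩ (hpos t ht) (hRmaps (Ioo_subset_Icc_self ht)).2,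
    integral_withDensity_ofReal continuous_parabolicDensity.measurable
      (parabolicDensity_nonneg hA)]

theorem isWeakSolution_homothetic (hd : 1 ≤ d) (hA : 0 < A) (hρ : 0 < ρ)
    (hprob : IsProbabilityMeasure (volume.withDensity fun x : EuclideanSpace ℝ (Fin d) =>
      ENNReal.ofReal (parabolicDensity A ρ x)))
    (hΩm : MeasurableSet Ω) (hΩ : Metric.closedBall 0 ρ ⊆ Ω)
    (hR : ContDiffOn ℝ 1 R (Icc 0 1)) (hRmaps : MapsTo R (Icc 0 1) (Icc 0 1))
    (hRmono : MonotoneOn R (Icc 0 1) ∨ AntitoneOn R (Icc 0 1))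
    (hRderiv : ∀ᵐ t ∂(volume.restrict (Icc (0 : ℝ) 1)), derivWithin R (Icc 0 1) t ≠ 0) :
    IsWeakSolution Ω 2 2 1 (1 / 2)
      (homotheticCurve R (volume.withDensity fun x => ENNReal.ofReal (parabolicDensity A ρ x)) 0)
      (homotheticCurve R (volume.withDensity fun x => ENNReal.ofReal (parabolicDensity A ρ x)) 1)
      (homotheticDensity R (parabolicDensity A ρ)) (homotheticField R) := by
  have hpos : ∀ t ∈ Ioo (0 : ℝ) 1, 0 < R t := fun t ht => scaling_pos hR hRmaps hRmono hRderiv ht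
  have hle : ∀ t ∈ Ioo (0 : ℝ) 1, R t ≤ 1 := fun t ht => (hRmaps (Ioo_subset_Icc_self ht)).2
  have hderiv : ∀ᵐ t, t ∈ Ioo (0 : ℝ) 1 → derivWithin R (Icc 0 1) t ≠ 0 :=
    ((ae_restrict_iff' measurableSet_Icc).1 hRderiv).mono
      fun t h ht => h (Ioo_subset_Icc_self ht)
  obtain ⟨σ, hσ, habs⟩ := exists_sign_abs_derivWithin hRmono
  have hσi : σ⁻¹ = σ := inv_eq_of_mul_eq_one_left hσ
  have hM := integral_parabolicDensity_mul_norm_sq_pos (d := d) hd hA hρ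
  have hIo : Ioo (0 : ℝ) 1 ⊆ Icc 0 1 := Ioo_subset_Icc_self
  have hcu := continuousOn_homotheticDensity (d := d)
    (continuous_parabolicDensity (A := A) (ρ := ρ)) (hR.continuousOn.mono hIo) hpos
  have hcR : ContinuousOn (fun z : ℝ × EuclideanSpace ℝ (Fin d) => R z.1) (Ioo 0 1 ×ˢ univ) :=
    hR.continuousOn.comp continuousOn_fst fun z hz => hIo hz.1
  have hcRd : ContinuousOn (fun z : ℝ × EuclideanSpace ℝ (Fin d) => (R z.1 ^ d)⁻¹)
      (Ioo 0 1 ×ˢ univ) := (hcR.pow d).inv₀ fun z hz => pow_ne_zero _ (hpos _ hz.1).ne'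
  have hcr : ContinuousOn (fun z : ℝ × EuclideanSpace ℝ (Fin d) => derivWithin R (Icc 0 1) z.1)
      (Ioo 0 1 ×ˢ univ) :=
    (continuousOn_derivWithin_Icc hR).comp continuousOn_fst fun z hz => hIo hz.1
  have hcx : ContinuousOn (fun z : ℝ × EuclideanSpace ℝ (Fin d) => (R z.1)⁻¹ • z.2)
      (Ioo 0 1 ×ˢ univ) := (hcR.inv₀ fun z hz => (hpos _ hz.1).ne').smul continuousOn_snd
  have hcxi : ∀ i, ContinuousOn (fun z : ℝ × EuclideanSpace ℝ (Fin d) => ((R z.1)⁻¹ • z.2) i)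
      (Ioo 0 1 ×ˢ univ) := fun i =>
    (EuclideanSpace.proj (𝕜 := ℝ) i).continuous.comp_continuousOn hcx
  have hv : ∀ t (x : EuclideanSpace ℝ (Fin d)),
      homotheticField R t x = derivWithin R (Icc 0 1) t • ((R t)⁻¹ • x) := fun t x => by
    rw [homotheticField, smul_smul, div_eq_mul_inv]
  have hH := fun t ht => coeffH_homothetic (A := A) hρ.le hΩ (hpos t ht) (hle t ht)
  have hK := fun t ht => coeffK_homothetic hA.le hρ.le hΩ (hpos t ht) (hle t ht)
  have hV := fun t ht => energyV_homotheticField (A := A) hρ.le hΩ (hpos t ht) (hle t ht)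
  simp only [habs] at hH hK
  have hs0 : 0 < √(∫ y : EuclideanSpace ℝ (Fin d), parabolicDensity A ρ y * ‖y‖ ^ 2) :=
    Real.sqrt_pos.2 hM
  set s := √(∫ y : EuclideanSpace ℝ (Fin d), parabolicDensity A ρ y * ‖y‖ ^ 2) with hs
  set F := ∫ y : EuclideanSpace ℝ (Fin d), parabolicDensity A ρ y ^ 2 with hF
  refine ⟨?_, ?_, ?_, ?_, ?_, ?_, ?_, ?_, ?_, ?_, ?_, ?_, ?_, ?_⟩
  · exact fun t ht x => homotheticDensity_nonneg (parabolicDensity_nonneg hA.le) (hpos t ht) x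
  · intro t ht
    have h := setIntegral_homotheticDensity_mul (A := A) hρ.le hΩ (hpos t ht) (hle t ht) fun _ => 1
    rw [← integral_withDensity_ofReal continuous_parabolicDensity.measurable
      (parabolicDensity_nonneg hA.le)] at h
    simpa using h
  · filter_upwards [ae_restrict_mem measurableSet_Ioo] with t ht
    simp only [Real.rpow_two, sq]
    exact integrableOn_of_continuous_mul_homotheticDensity hρ.le (hpos t ht) (hle t ht)
      (continuous_homotheticDensity continuous_parabolicDensity)
  · filter_upwards [ae_restrict_mem measurableSet_Ioo] with t ht
    simp only [Real.rpow_two]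
    exact integrableOn_of_continuous_mul_homotheticDensity hρ.le (hpos t ht) (hle t ht)
      ((continuous_homotheticField t).norm.pow 2)
  · intro _
    filter_upwards [ae_restrict_mem measurableSet_Ioo, ae_restrict_of_ae hderiv] with t ht hr
    have := hr ht
    rw [hV t ht]
    positivity
  · refine locallyIntegrableOn_of_ae_eq_continuousOn isOpen_Ioo isOpen_interior.measurableSet
      (((continuousOn_const (c := σ)).mul hcr).mul (continuousOn_const (c := s)) |>.neg.mul
        (hcu.pow 2)) (ae_of_all _ fun t ht x => ?_)
    rw [hH t ht, Real.rpow_two]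
    rfl
  -- The tensor is quadratic in `R'` while `K` is of order `1/|R'|`, so a single factor `R'`
  -- remains.
  · intro i j
    refine locallyIntegrableOn_of_ae_eq_continuousOn isOpen_Ioo isOpen_interior.measurableSet
      (g := fun z => σ * (F / s) * (R z.1 ^ d)⁻¹ *
        homotheticDensity R (parabolicDensity A ρ) z.1 z.2 * derivWithin R (Icc 0 1) z.1 *
        (((R z.1)⁻¹ • z.2) i * ((R z.1)⁻¹ • z.2) j))
      (((((continuousOn_const (c := σ * (F / s))).mul hcRd).mul hcu).mul hcr).mul
        ((hcxi i).mul (hcxi j))) ?_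
    filter_upwards [hderiv] with t ht htI x
    have hr := ht htI
    simp only [hK t htI, sub_self, Real.rpow_zero, hv, PiLp.smul_apply, smul_eq_mul]
    rw [mul_inv, mul_inv, hσi]
    field_simp
  -- Here `R'` disappears completely from the continuous representative.
  · refine locallyIntegrableOn_of_ae_eq_continuousOn isOpen_Ioo isOpen_interior.measurableSet
      (g := fun z => (σ * (F / s) * (R z.1 ^ d)⁻¹ *
        homotheticDensity R (parabolicDensity A ρ) z.1 z.2) • ((R z.1)⁻¹ • z.2))
      ((((continuousOn_const (c := σ * (F / s))).mul hcRd).mul hcu).smul hcx) ?_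
    filter_upwards [hderiv] with t ht htI x
    have hr := ht htI
    simp only [hK t htI, sub_self, Real.rpow_zero, hv, smul_smul]
    congr 1
    rw [mul_inv, mul_inv, hσi]
    field_simp
  · exact locallyIntegrableOn_of_ae_eq_continuousOn isOpen_Ioo hΩm hcu
      (ae_of_all _ fun t ht x => rfl)
  · exact locallyIntegrableOn_of_ae_eq_continuousOn isOpen_Ioo hΩm
      (hcu.smul (continuousOn_homotheticField hR hIo hpos)) (ae_of_all _ fun t ht x => rfl)
  · exact fun ξ hξ hξc hξs => weak_momentum_homothetic hd hA hρ hprob hΩm hΩ hR hRmaps hpos hσ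
      habs hderiv hξ hξc hξs
  · exact fun φ hφ hφc hφs => weak_continuity_homothetic hA.le hρ.le hprob hΩm hΩ hR hRmaps hpos
      hφ hφc hφs
  · intro f
    rw [← nhdsWithin_Ioo_eq_nhdsGT (one_pos : (0 : ℝ) < 1)]
    exact tendsto_integral_homotheticDensity hA.le hρ.le hprob hΩ hR hRmaps hpos f.continuous
      (left_mem_Icc.2 zero_le_one)
  · intro f
    rw [← nhdsWithin_Ioo_eq_nhdsLT (one_pos : (0 : ℝ) < 1)]
    exact tendsto_integral_homotheticDensity hA.le hρ.le hprob hΩ hR hRmaps hpos f.continuous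
      (right_mem_Icc.2 zero_le_one)

end WeakSolution

end WeightedWasserstein

theorem mainTheorem5 {d : ℕ} (hd : 1 ≤ d)
    (Ω : Set (EuclideanSpace ℝ (Fin d))) (hΩclosed : IsClosed Ω) (hΩconvex : Convex ℝ Ω)
    (A ρ : ℝ) (hρ : 0 < ρ)
    (μbar : Measure (EuclideanSpace ℝ (Fin d)))
    (hμprob : IsProbabilityMeasure μbar) (hμΩ : μbar Ωᶜ = 0)
    (hμdens : μbar = volume.withDensity
      (fun x => ENNReal.ofReal (WeightedWasserstein.parabolicDensity A ρ x)))
    (R : ℝ → ℝ) (hRreg : ContDiffOn ℝ 1 R (Icc 0 1))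
    (hRmaps : MapsTo R (Icc 0 1) (Icc 0 1))
    (hRmono : MonotoneOn R (Icc 0 1) ∨ AntitoneOn R (Icc 0 1))
    (hRderiv : ∀ᵐ t ∂(volume.restrict (Icc (0 : ℝ) 1)), derivWithin R (Icc 0 1) t ≠ 0) :
    WeightedWasserstein.IsLipschitzCurve Ω 2 (WeightedWasserstein.homotheticCurve R μbar) ∧
    WeightedWasserstein.IsTangentField Ω 2 (WeightedWasserstein.homotheticCurve R μbar)
      (WeightedWasserstein.homotheticField R) ∧
    (∀ t ∈ Ioo (0 : ℝ) 1, WeightedWasserstein.homotheticCurve R μbar t =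
      volume.withDensity (fun x => ENNReal.ofReal (WeightedWasserstein.homotheticDensity R
        (WeightedWasserstein.parabolicDensity A ρ) t x))) ∧
    WeightedWasserstein.IsWeakSolution Ω 2 2 1 (1 / 2)
      (WeightedWasserstein.homotheticCurve R μbar 0)
      (WeightedWasserstein.homotheticCurve R μbar 1)
      (WeightedWasserstein.homotheticDensity R (WeightedWasserstein.parabolicDensity A ρ))
      (WeightedWasserstein.homotheticField R) ∧
    WeightedWasserstein.NoFlux Ω
      (WeightedWasserstein.homotheticDensity R (WeightedWasserstein.parabolicDensity A ρ))
      (WeightedWasserstein.homotheticField R) := by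
  subst hμdens
  have hA := WeightedWasserstein.amplitude_pos hμprob rfl
  have hΩ := WeightedWasserstein.closedBall_subset_of_parabolicDensity hA hρ hΩclosed hμΩ
  have hν := WeightedWasserstein.withDensity_parabolicDensity_compl_closedBall (d := d) (A := A)
    hρ.le
  have hpos : ∀ t ∈ Ioo (0 : ℝ) 1, 0 < R t := fun t ht =>
    WeightedWasserstein.scaling_pos hRreg hRmaps hRmono hRderiv ht
  exact ⟨WeightedWasserstein.isLipschitzCurve_homotheticCurve hν hΩ hRreg hRmaps,
    WeightedWasserstein.isTangentField_homotheticField hρ hν hRreg hRmaps hpos,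
    fun t ht => WeightedWasserstein.homotheticCurve_eq_withDensity
      WeightedWasserstein.continuous_parabolicDensity.measurable (hpos t ht),
    WeightedWasserstein.isWeakSolution_homothetic hd hA hρ hμprob hΩclosed.measurableSet hΩ hRreg
      hRmaps hRmono hRderiv,
    WeightedWasserstein.noFlux_homothetic hρ hΩ hRmaps hpos⟩
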